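/- Let $S$ be a closed orientable hyperbolic surface with universal covering $\pi\colon\mathbb{H}^2\to S$ (a local isometry whose covering transformations preserve orientation), and let $\widetilde d$ be the hyperbolic distance. Let $f\colon S\to S$ be a homeomorphism isotopic to the identity, and let $\widetilde f$ be its preferred lift to $\mathbb{H}^2$, i.e. the unique lift commuting with all covering transformations. For $x\in S$ and $n\in\mathbb{N}$ put $L_n(x)=\widetilde d(\widetilde x,\widetilde f^{\,n}(\widetilde x))$, where $\widetilde x$ is any lift of $x$. The rotation speed of $x$ is $$\vartheta(x)=\lim_{n\to+\infty}\tfrac1n L_n(x)=\lim_{n\to+\infty}\tfrac1n L_n(f^{-n}(x)),$$ defined when both limits exist and coincide. An ergodic $f$-invariant Borel probability measure $\mu$ has rotation speed $\vartheta_\mu$ if $\vartheta(x)=\vartheta_\mu$ for $\mu$-almost every $x$. A geodesic is a local isometry $\gamma\colon\mathbb{R}\to S$. It is a tracking geodesic for $x$ if $\vartheta(x)>0$ and, for each lift $\widetilde x$ of $x$, there is a lift $\widetilde\gamma$ of $\gamma$ such that $$\lim_{n\to+\infty}\tfrac1n\,\widetilde d\big(\widetilde f^{\,n}(\widetilde x),\widetilde\gamma(n\vartheta(x))\big)=\lim_{n\to+\infty}\tfrac1n\,\widetilde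 d\big(\widetilde f^{\,-n}(\widetilde x),\widetilde\gamma(-n\vartheta(x))\big)=0.\qquad(*)$$ A tracking geodesic $\gamma$ for $x$ is normalized if there exist lifts $\widetilde x$ of $x$ and $\widetilde\gamma$ of $\gamma$ satisfying $(*)$ with $\widetilde d(\widetilde x,\widetilde\gamma(0))=\widetilde d(\widetilde x,\widetilde\gamma(\mathbb{R}))$. The space of geodesics carries the Borel structure of the topology of uniform convergence on compact sets (equivalently, that of the unit tangent bundle $\mathrm{T}^1S$ via $\gamma\mapsto\dot\gamma(0)$). Theorem 1.7. The set $S_T$ of points of $S$ that admit a tracking geodesic is a Borel set, and $\mu(S_T)=1$ for every ergodic $f$-invariant Borel probability measure $\mu$ on $S$ with rotation speed $\vartheta_\mu>0$. Furthermore, each $x\in S_T$ has a unique normalized tracking geodesic $\gamma_x$, and the map $x\mapsto\gamma_x$ from $S_T$ to the space of geodesics is Borel. -/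

import Mathlib

open Filter Topology MeasureTheory UpperHalfPlane

open scoped MatrixGroups

/-- A map between metric spaces is a *local isometry* if every point has a neighbourhood on which
the map preserves distances. -/
def IsLocalIsometry {X Y : Type*} [MetricSpace X] [MetricSpace Y] (h : X → Y) : Prop :=
  ∀ x : X, ∃ U ∈ 𝓝 x, ∀ y ∈ U, ∀ z ∈ U, dist (h y) (h z) = dist y z

/-- `IsDeck p g`: the self-homeomorphism `g` of the total space is a covering transformation
of `p`. -/
def IsDeck {E X : Type*} [TopologicalSpace E] (p : E → X) (g : E ≃ₜ E) : Prop :=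
  ∀ z, p (g z) = p z

/-- An orientable hyperbolic surface structure on the metric space `S`: a universal covering
`ℍ → S` by the hyperbolic plane (with its hyperbolic distance) which is a local isometry, and whose
covering transformations preserve the orientation, i.e. are Möbius transformations given by real
matrices of determinant one. The surface is *closed* when in addition `S` is compact. -/
structure HyperbolicSurface (S : Type*) [MetricSpace S] where
  /-- the universal covering projection -/
  proj : ℍ → S
  isCoveringMap : IsCoveringMap proj
  surjective : Function.Surjective proj
  isLocalIsometry : IsLocalIsometry proj
  orientable : ∀ g : ℍ ≃ₜ ℍ, IsDeck proj g → ∃ A : SL(2, ℝ), ∀ z : ℍ, g z = A • z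

/-- The homeomorphism `f` is isotopic to the identity. -/
def IsIsotopicToId {S : Type*} [TopologicalSpace S] (f : S ≃ₜ S) : Prop :=
  ∃ H : C(unitInterval × S, S), (∀ t, IsHomeomorph fun x => H (t, x)) ∧
    (∀ x, H (0, x) = x) ∧ ∀ x, H (1, x) = f x

/-- A geodesic of `S` is a local isometry `ℝ → S`. -/
def Geodesic (S : Type*) [MetricSpace S] : Type _ :=
  {γ : C(ℝ, S) // IsLocalIsometry γ}

namespace Geodesic

variable {S : Type*} [MetricSpace S]

instance : CoeFun (Geodesic S) fun _ => ℝ → S := ⟨fun γ => γ.1⟩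

/-- The space of geodesics carries the topology of uniform convergence on compact sets. For a
closed hyperbolic surface this is the topology for which `γ ↦ γ'(0)` is a homeomorphism onto the
unit tangent bundle. -/
instance : TopologicalSpace (Geodesic S) := instTopologicalSpaceSubtype

instance : MeasurableSpace (Geodesic S) := borel _

instance : BorelSpace (Geodesic S) := ⟨rfl⟩

end Geodesic

namespace HyperbolicSurface

variable {S : Type*} [MetricSpace S] (c : HyperbolicSurface S)

/-- `F` is a lift of `f` to the universal cover that commutes with all covering
transformations. -/
structure IsPreferredLift (f : S ≃ₜ S) (F : ℍ ≃ₜ ℍ) : Prop where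
  proj_apply : ∀ z, c.proj (F z) = f (c.proj z)
  commutes : ∀ g : ℍ ≃ₜ ℍ, IsDeck c.proj g → ∀ z, F (g z) = g (F z)

theorem eq_of_proj_eq {F G : ℍ → ℍ} (hF : Continuous F) (hG : Continuous G)
    (h : ∀ z, c.proj (F z) = c.proj (G z)) {z : ℍ} (hz : F z = G z) : F = G :=
  c.isCoveringMap.eq_of_comp_eq hF hG (funext h) z hz

theorem exists_deck {z w : ℍ} (h : c.proj z = c.proj w) :
    ∃ g : ℍ ≃ₜ ℍ, IsDeck c.proj g ∧ g z = w := by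
  let p : C(ℍ, S) := ⟨c.proj, c.isCoveringMap.continuous⟩
  obtain ⟨F, ⟨hF1, hF2⟩, -⟩ :=
    c.isCoveringMap.existsUnique_continuousMap_lifts p z w h.symm
  obtain ⟨G, ⟨hG1, hG2⟩, -⟩ :=
    c.isCoveringMap.existsUnique_continuousMap_lifts p w z h
  have hF : ∀ x, c.proj (F x) = c.proj x := fun x => congrFun hF2 x
  have hG : ∀ x, c.proj (G x) = c.proj x := fun x => congrFun hG2 x
  have h1 : (fun x => G (F x)) = fun x => x :=
    c.eq_of_proj_eq (by fun_prop) (by fun_prop) (fun x => by rw [hG, hF]) (z := z)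
      (by rw [hF1, hG1])
  have h2 : (fun x => F (G x)) = fun x => x :=
    c.eq_of_proj_eq (by fun_prop) (by fun_prop) (fun x => by rw [hF, hG]) (z := w)
      (by rw [hG1, hF1])
  exact ⟨{ toFun := F, invFun := G, left_inv := congrFun h1, right_inv := congrFun h2,
           continuous_toFun := F.continuous, continuous_invFun := G.continuous }, hF, hF1⟩

theorem exists_isPreferredLift {f : S ≃ₜ S} (hf : IsIsotopicToId f) :
    ∃ F : ℍ ≃ₜ ℍ, c.IsPreferredLift f F := by
  obtain ⟨H, -, H0, H1⟩ := hf
  have hp : Continuous c.proj := c.isCoveringMap.continuous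
  let K : C(unitInterval × ℍ, S) := ⟨fun q => H (q.1, c.proj q.2), by fun_prop⟩
  have K0 : ∀ z, K (0, z) = c.proj (ContinuousMap.id ℍ z) := fun z => H0 _
  let G := c.isCoveringMap.liftHomotopy K (ContinuousMap.id ℍ) K0
  have hG : ∀ q, c.proj (G q) = K q :=
    congrFun (c.isCoveringMap.liftHomotopy_lifts K (ContinuousMap.id ℍ) K0)
  have hG0 : ∀ z, G (0, z) = z :=
    c.isCoveringMap.liftHomotopy_zero K (ContinuousMap.id ℍ) K0
  have hGg : ∀ (g : ℍ ≃ₜ ℍ), IsDeck c.proj g → ∀ z t, G (t, g z) = g (G (t, z)) := by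
    intro g hg z t
    have := c.isCoveringMap.eq_of_comp_eq (g₁ := fun t : unitInterval => G (t, g z))
      (g₂ := fun t => g (G (t, z))) (by fun_prop) (by fun_prop)
      (by
        funext t
        change c.proj (G (t, g z)) = c.proj (g (G (t, z)))
        rw [hg, hG, hG]
        change H (t, c.proj (g z)) = H (t, c.proj z)
        rw [hg]) 0 (by simp only [hG0])
    exact congrFun this t
  let F : C(ℍ, ℍ) := ⟨fun z => G (1, z), by fun_prop⟩
  have hF : ∀ z, c.proj (F z) = f (c.proj z) := fun z => (hG (1, z)).trans (H1 _)
  have hFg : ∀ g : ℍ ≃ₜ ℍ, IsDeck c.proj g → ∀ z, F (g z) = g (F z) :=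
    fun g hg z => hGg g hg z 1
  have hinj : Function.Injective F := by
    intro z w h
    have h1 : c.proj z = c.proj w := f.injective (by rw [← hF, ← hF, h])
    obtain ⟨g, hg, rfl⟩ := c.exists_deck h1
    rw [hFg g hg] at h
    have := c.eq_of_proj_eq (F := fun x => x) (G := g) continuous_id g.continuous
      (fun x => (hg x).symm) h
    exact congrFun this z
  have hsurj : Function.Surjective F := by
    intro y
    obtain ⟨z, hz⟩ := c.surjective (f.symm (c.proj y))
    have : c.proj (F z) = c.proj y := by rw [hF, hz, f.apply_symm_apply]
    obtain ⟨g, hg, hgy⟩ := c.exists_deck this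
    exact ⟨g z, by rw [hFg g hg, hgy]⟩
  have hloc : IsLocalHomeomorph F := by
    have h1 : IsLocalHomeomorph (c.proj ∘ F) := by
      have : c.proj ∘ F = f ∘ c.proj := funext hF
      rw [this]
      exact f.isLocalHomeomorph.comp c.isCoveringMap.isLocalHomeomorph
    exact h1.of_comp c.isCoveringMap.isLocalHomeomorph F.continuous
  let F' : ℍ ≃ₜ ℍ := (Equiv.ofBijective F ⟨hinj, hsurj⟩).toHomeomorphOfContinuousOpen
    F.continuous hloc.isOpenMap
  exact ⟨F', hF, hFg⟩

theorem smul_eq_of_dist_le (A : SL(2, ℝ)) (D : ℝ) (h : ∀ z : ℍ, dist z (A • z) ≤ D) (z : ℍ) :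
    A • z = z := by
  have hdet : A 0 0 * A 1 1 - A 0 1 * A 1 0 = 1 := by
    have := A.det_coe
    rwa [Matrix.det_fin_two] at this
  have key : ∀ z : ℍ, Complex.normSq (A 1 0 * (z : ℂ) ^ 2 + (A 1 1 - A 0 0) * z - A 0 1) ≤
      2 * z.im ^ 2 * Real.cosh D := by
    intro z
    have hD : Real.cosh (dist z (A • z)) ≤ Real.cosh D := by
      rw [Real.cosh_le_cosh, abs_of_nonneg dist_nonneg]
      exact (h z).trans (le_abs_self D)
    have hne : (A 1 0 * (z : ℂ) + A 1 1) ≠ 0 := by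
      have := denom_ne_zero (A : GL (Fin 2) ℝ) z
      simpa [denom] using this
    have hsmul : ((A • z : ℍ) : ℂ) = (A 0 0 * z + A 0 1) / (A 1 0 * z + A 1 1) := by
      simpa using coe_specialLinearGroup_apply A z
    have hN : 0 < Complex.normSq (A 1 0 * (z : ℂ) + A 1 1) := Complex.normSq_pos.2 hne
    have him : (A • z : ℍ).im * Complex.normSq (A 1 0 * (z : ℂ) + A 1 1) = z.im := by
      rw [← coe_im, hsmul, Complex.div_im, div_sub_div_same, div_mul_cancel₀ _ hN.ne']
      simp
      linear_combination z.im * hdet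
    have hdist : dist (z : ℂ) (A • z : ℍ) ^ 2 * Complex.normSq (A 1 0 * (z : ℂ) + A 1 1) =
        Complex.normSq (A 1 0 * (z : ℂ) ^ 2 + (A 1 1 - A 0 0) * z - A 0 1) := by
      rw [dist_eq_norm, ← Complex.normSq_eq_norm_sq, ← Complex.normSq_mul, hsmul]
      congr 1
      rw [sub_mul, div_mul_cancel₀ _ hne]
      ring
    rw [cosh_dist] at hD
    have h2 : dist (z : ℂ) (A • z : ℍ) ^ 2 ≤ Real.cosh D * (2 * z.im * (A • z : ℍ).im) := by
      rw [← div_le_iff₀ (by have := z.im_pos; have := (A • z : ℍ).im_pos; positivity)]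
      linarith
    rw [← hdist]
    calc _ ≤ Real.cosh D * (2 * z.im * (A • z : ℍ).im) *
          Complex.normSq (A 1 0 * (z : ℂ) + A 1 1) := by gcongr
      _ = 2 * z.im ^ 2 * Real.cosh D := by
        rw [mul_assoc, mul_assoc (2 * z.im), him]; ring
  have key2 : ∀ x y : ℝ, 0 < y →
      (A 1 0 * (x ^ 2 - y ^ 2) + (A 1 1 - A 0 0) * x - A 0 1) ^ 2 ≤
        2 * y ^ 2 * Real.cosh D := by
    intro x y hy
    have := key ⟨⟨x, y⟩, hy⟩
    rw [Complex.normSq_apply] at this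
    simp [pow_two] at this
    nlinarith [this, mul_self_nonneg (A 1 0 * (x * y + y * x) + (A 1 1 - A 0 0) * y)]
  have hb2 : ∀ x : ℝ, (A 1 0 * x ^ 2 + (A 1 1 - A 0 0) * x - A 0 1) ^ 2 ≤ 0 := by
    intro x
    have t1 : Tendsto (fun y : ℝ => (A 1 0 * (x ^ 2 - y ^ 2) + (A 1 1 - A 0 0) * x - A 0 1) ^ 2)
        (𝓝[>] 0) (𝓝 ((A 1 0 * (x ^ 2 - 0 ^ 2) + (A 1 1 - A 0 0) * x - A 0 1) ^ 2)) :=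
      tendsto_nhdsWithin_of_tendsto_nhds (Continuous.tendsto (by fun_prop) 0)
    have t2 : Tendsto (fun y : ℝ => 2 * y ^ 2 * Real.cosh D) (𝓝[>] 0)
        (𝓝 (2 * 0 ^ 2 * Real.cosh D)) :=
      tendsto_nhdsWithin_of_tendsto_nhds (Continuous.tendsto (by fun_prop) 0)
    have := le_of_tendsto_of_tendsto t1 t2
      (eventually_nhdsWithin_of_forall fun y hy => key2 x y hy)
    simpa using this
  have hb3 : ∀ x : ℝ, A 1 0 * x ^ 2 + (A 1 1 - A 0 0) * x - A 0 1 = 0 := fun x =>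
    pow_eq_zero_iff (two_ne_zero) |>.1 (le_antisymm (hb2 x) (sq_nonneg _))
  have e0 := hb3 0
  have e1 := hb3 1
  have e2 := hb3 (-1)
  have hb : A 0 1 = 0 := by linarith
  have hc : A 1 0 = 0 := by linarith
  have hd : A 1 1 = A 0 0 := by linarith
  have ha : (A 0 0 : ℂ) ≠ 0 := by
    intro h0
    have : A 0 0 = 0 := by exact_mod_cast h0
    rw [hb, this] at hdet
    simp at hdet
  have hsmul : ((A • z : ℍ) : ℂ) = (A 0 0 * z + A 0 1) / (A 1 0 * z + A 1 1) := by
    simpa using coe_specialLinearGroup_apply A z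
  apply UpperHalfPlane.ext
  rw [hsmul, hb, hc, hd]
  simp only [Complex.ofReal_zero, add_zero, zero_mul, zero_add]
  exact mul_div_cancel_left₀ _ ha

/-- On a closed hyperbolic surface the preferred lift is unique. -/
theorem IsPreferredLift.unique [CompactSpace S] {f : S ≃ₜ S} {F G : ℍ ≃ₜ ℍ}
    (hF : c.IsPreferredLift f F) (hG : c.IsPreferredLift f G) : F = G := by
  let g : ℍ ≃ₜ ℍ := F.symm.trans G
  have hgF : ∀ z, g (F z) = G z := fun z => by simp [g]
  have hg : IsDeck c.proj g := fun z => by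
    obtain ⟨w, rfl⟩ := F.surjective z
    rw [hgF, hG.proj_apply, hF.proj_apply]
  have hcomm : ∀ k : ℍ ≃ₜ ℍ, IsDeck c.proj k → ∀ z, g (k z) = k (g z) := fun k hk z => by
    obtain ⟨w, rfl⟩ := F.surjective z
    rw [← hF.commutes k hk, hgF, hgF, hG.commutes k hk]
  obtain ⟨A, hA⟩ := c.orientable g hg
  have hU : ∀ n : ℕ, IsOpen (c.proj '' Metric.ball UpperHalfPlane.I n) := fun n =>
    c.isCoveringMap.isLocalHomeomorph.isOpenMap _ Metric.isOpen_ball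
  have hcov : (Set.univ : Set S) ⊆ ⋃ n : ℕ, c.proj '' Metric.ball UpperHalfPlane.I n := by
    intro x _
    obtain ⟨z, rfl⟩ := c.surjective x
    obtain ⟨n, hn⟩ := exists_nat_gt (dist z UpperHalfPlane.I)
    exact Set.mem_iUnion.2 ⟨n, z, hn, rfl⟩
  obtain ⟨n, hn⟩ := isCompact_univ.elim_directed_cover _ hU hcov
    (directed_of_isDirected_le fun m n hmn =>
      Set.image_mono (Metric.ball_subset_ball (by exact_mod_cast hmn)))
  obtain ⟨D, hD⟩ := (isCompact_closedBall UpperHalfPlane.I (n : ℝ)).bddAbove_image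
    (f := fun z : ℍ => dist z (g z)) (Continuous.continuousOn (by fun_prop))
  have hbd : ∀ z : ℍ, dist z (A • z) ≤ D := by
    intro z
    obtain ⟨w, hw, hwz⟩ := hn (Set.mem_univ (c.proj z))
    obtain ⟨k, hk, rfl⟩ := c.exists_deck hwz
    obtain ⟨B, hB⟩ := c.orientable k hk
    rw [← hA, hcomm k hk, hB, hB, dist_smul]
    exact hD ⟨w, Metric.ball_subset_closedBall hw, rfl⟩
  ext1 z
  rw [← hgF, hA, smul_eq_of_dist_le A D hbd]

/-- The preferred lift of a homeomorphism isotopic to the identity; on a closed surface it is unique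
by `IsPreferredLift.unique`. -/
noncomputable def preferredLift {f : S ≃ₜ S} (hf : IsIsotopicToId f) : ℍ ≃ₜ ℍ :=
  (c.exists_isPreferredLift hf).choose

theorem isPreferredLift_preferredLift {f : S ≃ₜ S} (hf : IsIsotopicToId f) :
    c.IsPreferredLift f (c.preferredLift hf) :=
  (c.exists_isPreferredLift hf).choose_spec

/-- A chosen lift of a point of `S`. -/
noncomputable def lift (x : S) : ℍ := (c.surjective x).choose

theorem proj_lift (x : S) : c.proj (c.lift x) = x := (c.surjective x).choose_spec

/-- The rotation distance `L_n(x)`: the distance from a lift of `x` to its image under the `n`-th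
iterate of the preferred lift. By `rotationDist_proj` it does not depend on the lift. -/
noncomputable def rotationDist {f : S ≃ₜ S} (hf : IsIsotopicToId f) (n : ℕ) (x : S) : ℝ :=
  dist (c.lift x) ((c.preferredLift hf ^ n) (c.lift x))

theorem rotationDist_proj {f : S ≃ₜ S} (hf : IsIsotopicToId f) (n : ℕ) (z : ℍ) :
    c.rotationDist hf n (c.proj z) = dist z ((c.preferredLift hf ^ n) z) := by
  obtain ⟨g, hg, hgz⟩ := c.exists_deck (c.proj_lift (c.proj z)).symm
  obtain ⟨A, hA⟩ := c.orientable g hg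
  have hcomm : ∀ n : ℕ, ∀ w, (c.preferredLift hf ^ n) (g w) = g ((c.preferredLift hf ^ n) w) := by
    intro n
    induction n with
    | zero => intro w; rfl
    | succ k ih =>
      intro w
      rw [pow_succ, Homeomorph.mul_apply, Homeomorph.mul_apply,
        (c.isPreferredLift_preferredLift hf).commutes g hg, ih]
  rw [rotationDist, ← hgz, hcomm, hA, hA, dist_smul]

/-- The rotation speed of `x` exists and equals `v`, i.e. `ϑ(x) = v`. -/
def HasRotationSpeed {f : S ≃ₜ S} (hf : IsIsotopicToId f) (x : S) (v : ℝ) : Prop :=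
  Tendsto (fun n : ℕ => c.rotationDist hf n x / n) atTop (𝓝 v) ∧
    Tendsto (fun n : ℕ => c.rotationDist hf n ((f ^ (-(n : ℤ))) x) / n) atTop (𝓝 v)

/-- The path `γ'` of the hyperbolic plane is a lift of the geodesic `γ` of `S`. -/
def IsGeodesicLift (γ : Geodesic S) (γ' : C(ℝ, ℍ)) : Prop :=
  ∀ t, c.proj (γ' t) = γ t

/-- The tracking equation: the full orbit of `z` under the preferred lift is at sublinear distance
from the path `γ'` run at speed `v`. -/
def Tracks {f : S ≃ₜ S} (hf : IsIsotopicToId f) (z : ℍ) (γ' : C(ℝ, ℍ)) (v : ℝ) : Prop :=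
  Tendsto (fun n : ℕ => dist ((c.preferredLift hf ^ n) z) (γ' (n * v)) / n) atTop (𝓝 0) ∧
    Tendsto (fun n : ℕ => dist ((c.preferredLift hf ^ (-(n : ℤ))) z) (γ' (-(n * v))) / n)
      atTop (𝓝 0)

/-- `γ` is a tracking geodesic for `x`. -/
def IsTrackingGeodesic {f : S ≃ₜ S} (hf : IsIsotopicToId f) (x : S) (γ : Geodesic S) : Prop :=
  ∃ v : ℝ, 0 < v ∧ c.HasRotationSpeed hf x v ∧
    ∀ z : ℍ, c.proj z = x → ∃ γ' : C(ℝ, ℍ), c.IsGeodesicLift γ γ' ∧ c.Tracks hf z γ' v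

/-- `γ` is a normalized tracking geodesic for `x`: for some lifts `z` of `x` and `γ'` of `γ` which
satisfy the tracking equation, `γ' 0` is a point of `γ'` closest to `z`. -/
def IsNormalizedTrackingGeodesic {f : S ≃ₜ S} (hf : IsIsotopicToId f) (x : S)
    (γ : Geodesic S) : Prop :=
  c.IsTrackingGeodesic hf x γ ∧
    ∃ v : ℝ, c.HasRotationSpeed hf x v ∧ ∃ (z : ℍ) (γ' : C(ℝ, ℍ)), c.proj z = x ∧
      c.IsGeodesicLift γ γ' ∧ c.Tracks hf z γ' v ∧
        dist z (γ' 0) = Metric.infDist z (Set.range γ')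

/-- The set of points of `S` that admit a tracking geodesic. -/
def trackingSet {f : S ≃ₜ S} (hf : IsIsotopicToId f) : Set S :=
  {x | ∃ γ : Geodesic S, c.IsTrackingGeodesic hf x γ}

/-- The measure `μ` has rotation speed `v`: almost every point has rotation speed `v`. -/
def MeasureHasRotationSpeed [MeasurableSpace S] {f : S ≃ₜ S} (hf : IsIsotopicToId f)
    (μ : Measure S) (v : ℝ) : Prop :=
  ∀ᵐ x ∂μ, c.HasRotationSpeed hf x v

end HyperbolicSurface

/-! Everything happens in the hyperbolic plane, in the hyperboloid model, where the Minkowski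
product of two points is the hyperbolic cosine of their distance. "Distance `o(n)`" then becomes
"product of subexponential growth", and the geometry becomes algebra with exponentials.

Existence. The displacement of the preferred lift is bounded, because it descends to the compact
surface. An orbit with bounded jumps and linear escape speed `v > 0` converges in the Klein disc to
a point at infinity at exponential rate `v`, up to subexponential factors (`exists_direction`). This
applies to the past and to the future. If the two ends differ, the geodesic joining them tracks the
orbit (`AxisData.tendsto_dist_axis` and its twin). If they coincide, the past and the future stay at
sublinear distance (`tendsto_dist_div_of_same_direction`). Conversely a tracked orbit has its past
and future about `2nv` apart. Hence `mem_trackingSet_iff`: `x` admits a tracking geodesic iff its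
speed exists and is positive and `L_{2n}(f^{-n} x) / n` does not tend to `0`. This criterion
involves only continuous functions on `S`, so the set is Borel.

Full measure. `L_{2n} / n` tends to `2v` almost everywhere, hence in measure. Composing its `n`-th
term with the measure preserving map `f^{-n}` keeps convergence in measure, so a subsequence of the
spreads tends to `2v > 0` almost everywhere, which excludes the limit `0`.

Uniqueness. A geodesic is `exp t • a + exp (-t) • b` with `a`, `b` null vectors. Two geodesics at
sublinear distance have proportional coefficients, so they differ by a time shift, which the
normalization makes zero (`eq_of_sublinear_of_isMin`).

Measurability. In the cover, the two ends are pointwise limits of continuous functions and the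
geodesic depends continuously on the ends and the point. By uniqueness the result depends only on
the projection, and measurability descends along the surjection. -/

namespace Hyperboloid

/-! ### The hyperboloid and Klein models. -/

theorem eq_of_cosh_eq {x y : ℝ} (hx : 0 ≤ x) (hy : 0 ≤ y) (h : Real.cosh x = Real.cosh y) :
    x = y := by
  have h1 := Real.cosh_le_cosh.1 h.le
  have h2 := Real.cosh_le_cosh.1 h.ge
  rw [abs_of_nonneg hx, abs_of_nonneg hy] at h1 h2
  exact le_antisymm h1 h2

/-- The Minkowski form of signature `(1, 2)` on `ℝ × ℂ`. -/
def lor (u w : ℝ × ℂ) : ℝ := u.1 * w.1 - u.2.re * w.2.re - u.2.im * w.2.im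

/-- The hyperboloid model of the hyperbolic plane. -/
noncomputable def toHyp (z : ℍ) : ℝ × ℂ :=
  ((z.re ^ 2 + z.im ^ 2 + 1) / (2 * z.im),
    ⟨z.re / z.im, (z.re ^ 2 + z.im ^ 2 - 1) / (2 * z.im)⟩)

/-- The inverse of `toHyp` on the upper sheet of the hyperboloid. -/
noncomputable def ofHyp (u : ℝ × ℂ) : ℍ :=
  -- Writing the inverse of `u.1 - u.2.im` as `exp (-log _)` keeps the imaginary part positive for
  -- every `u`, on the hyperboloid or not.
  ⟨⟨u.2.re / (u.1 - u.2.im), Real.exp (-Real.log (u.1 - u.2.im))⟩, Real.exp_pos _⟩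

theorem lor_add_left (u v w : ℝ × ℂ) : lor (u + v) w = lor u w + lor v w := by
  simp [lor]; ring

theorem lor_sub_left (u v w : ℝ × ℂ) : lor (u - v) w = lor u w - lor v w := by
  simp [lor]; ring

theorem lor_smul_left (r : ℝ) (u w : ℝ × ℂ) : lor (r • u) w = r * lor u w := by
  simp [lor]; ring

theorem lor_comm (u w : ℝ × ℂ) : lor u w = lor w u := by
  simp only [lor]; ring

theorem lor_add_right (u v w : ℝ × ℂ) : lor u (v + w) = lor u v + lor u w := by
  simp [lor]; ring

theorem lor_sub_right (u v w : ℝ × ℂ) : lor u (v - w) = lor u v - lor u w := by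
  simp [lor]; ring

theorem lor_smul_right (r : ℝ) (u w : ℝ × ℂ) : lor u (r • w) = r * lor u w := by
  simp [lor]; ring

theorem lor_toHyp (z w : ℍ) : lor (toHyp z) (toHyp w) = Real.cosh (dist z w) := by
  have hz := z.im_pos.ne'
  have hw := w.im_pos.ne'
  rw [UpperHalfPlane.cosh_dist', lor, toHyp, toHyp]
  simp only
  field_simp
  ring

theorem lor_toHyp_self (z : ℍ) : lor (toHyp z) (toHyp z) = 1 := by
  rw [lor_toHyp, dist_self, Real.cosh_zero]

theorem toHyp_fst (z : ℍ) : (toHyp z).1 = Real.cosh (dist I z) := by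
  rw [← lor_toHyp]
  simp [lor, toHyp, UpperHalfPlane.I_re, UpperHalfPlane.I_im]

theorem toHyp_fst_pos (z : ℍ) : 0 < (toHyp z).1 := by
  rw [toHyp_fst]; exact Real.cosh_pos _

theorem toHyp_injective : Function.Injective toHyp := by
  intro z w h
  have h1 := lor_toHyp z w
  rw [h, lor_toHyp_self] at h1
  by_contra hne
  have := Real.one_lt_cosh.2 (dist_pos.2 hne).ne'
  linarith

theorem fst_sub_im_pos {u : ℝ × ℂ} (hu : lor u u = 1) (h0 : 0 < u.1) : 0 < u.1 - u.2.im := by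
  have h : u.2.im ^ 2 < u.1 ^ 2 := by
    have : u.1 * u.1 - u.2.re * u.2.re - u.2.im * u.2.im = 1 := hu
    nlinarith [mul_self_nonneg u.2.re]
  have := abs_lt_of_sq_lt_sq h h0.le
  linarith [le_abs_self u.2.im]

theorem toHyp_ofHyp {u : ℝ × ℂ} (hu : lor u u = 1) (h0 : 0 < u.1) : toHyp (ofHyp u) = u := by
  have hp := fst_sub_im_pos hu h0
  have hu' : u.1 * u.1 - u.2.re * u.2.re - u.2.im * u.2.im = 1 := hu
  have him : (ofHyp u).im = (u.1 - u.2.im)⁻¹ := by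
    change Real.exp (-Real.log (u.1 - u.2.im)) = _
    rw [Real.exp_neg, Real.exp_log hp]
  have hre : (ofHyp u).re = u.2.re / (u.1 - u.2.im) := rfl
  have hne := hp.ne'
  obtain ⟨τ, x, y⟩ := u
  simp only at *
  rw [toHyp, him, hre]
  refine Prod.ext ?_ (Complex.ext ?_ ?_)
  · simp only
    field_simp
    linear_combination -hu'
  · simp only
    field_simp
  · simp only
    field_simp
    linear_combination -hu'

theorem continuous_toHyp : Continuous toHyp := by
  have h : ∀ z : ℍ, z.im ≠ 0 := fun z => z.im_pos.ne'
  have h' : ∀ z : ℍ, 2 * z.im ≠ 0 := fun z => mul_ne_zero two_ne_zero (h z)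
  have hre := UpperHalfPlane.continuous_re
  have him := UpperHalfPlane.continuous_im
  have e : toHyp = fun z : ℍ => ((z.re ^ 2 + z.im ^ 2 + 1) / (2 * z.im),
      ((z.re / z.im : ℝ) : ℂ) + (((z.re ^ 2 + z.im ^ 2 - 1) / (2 * z.im) : ℝ) : ℂ) * Complex.I) := by
    funext z
    rw [← Complex.mk_eq_add_mul_I]; rfl
  rw [e]
  refine Continuous.prodMk (Continuous.div (by fun_prop) (by fun_prop) h')
    (Continuous.add (Complex.continuous_ofReal.comp (Continuous.div hre him h))
      ((Complex.continuous_ofReal.comp (Continuous.div (by fun_prop) (by fun_prop) h')).mul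
        continuous_const))

theorem continuous_ofHyp_comp {X : Type*} [TopologicalSpace X] {u : X → ℝ × ℂ}
    (hu : Continuous u) (h1 : ∀ x, lor (u x) (u x) = 1) (h0 : ∀ x, 0 < (u x).1) :
    Continuous fun x => ofHyp (u x) := by
  have hne : ∀ x, (u x).1 - (u x).2.im ≠ 0 := fun x => (fst_sub_im_pos (h1 x) (h0 x)).ne'
  rw [UpperHalfPlane.isEmbedding_coe.continuous_iff]
  have e : (UpperHalfPlane.coe ∘ fun x => ofHyp (u x)) = fun x =>
      (((u x).2.re / ((u x).1 - (u x).2.im) : ℝ) : ℂ) +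
        ((Real.exp (-Real.log ((u x).1 - (u x).2.im)) : ℝ) : ℂ) * Complex.I := by
    funext x
    rw [← Complex.mk_eq_add_mul_I]; rfl
  rw [e]
  have h2 : Continuous fun x => (u x).1 - (u x).2.im := by fun_prop
  refine (Complex.continuous_ofReal.comp (Continuous.div (by fun_prop) h2 hne)).add
      ((Complex.continuous_ofReal.comp (Real.continuous_exp.comp (h2.log hne).neg)).mul
        continuous_const)

/-- The Klein model of the hyperbolic plane. -/
noncomputable def klein (z : ℍ) : ℂ :=
  ⟨(toHyp z).2.re / (toHyp z).1, (toHyp z).2.im / (toHyp z).1⟩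

theorem continuous_klein : Continuous klein := by
  have e : klein = fun z : ℍ => (toHyp z).2 / ((toHyp z).1 : ℂ) := by
    funext z
    apply Complex.ext <;> simp [klein]
  rw [e]
  exact Continuous.div continuous_toHyp.snd (Complex.continuous_ofReal.comp continuous_toHyp.fst)
    fun z => by exact_mod_cast (toHyp_fst_pos z).ne'

/-- Shows that points at bounded distance from each other, far from `I`, are exponentially close in
the Klein disc: the first coordinate is the hyperbolic cosine of the distance to `I`. -/
theorem normSq_klein_sub (z w : ℍ) : Complex.normSq (klein z - klein w) =
    2 * Real.cosh (dist z w) / ((toHyp z).1 * (toHyp w).1) - 1 / (toHyp z).1 ^ 2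
      - 1 / (toHyp w).1 ^ 2 := by
  have hz := (toHyp_fst_pos z).ne'
  have hw := (toHyp_fst_pos w).ne'
  have h1 := lor_toHyp_self z
  have h2 := lor_toHyp_self w
  rw [← lor_toHyp]
  rw [lor] at *
  simp only [klein, Complex.normSq_apply, Complex.sub_re, Complex.sub_im]
  field_simp
  linear_combination (-(toHyp w).1 ^ 2) * h1 + (-(toHyp z).1 ^ 2) * h2

theorem normSq_klein (z : ℍ) : Complex.normSq (klein z) = 1 - 1 / (toHyp z).1 ^ 2 := by
  have hz := (toHyp_fst_pos z).ne'
  have h1 := lor_toHyp_self z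
  rw [lor] at h1
  simp only [klein, Complex.normSq_apply]
  field_simp
  linear_combination -h1

/-- The left side is the exponential of a Busemann function at `θ`. The right side bounds it by the
height and the Euclidean closeness to `θ`, the two quantities controlled along an orbit. -/
theorem lor_toHyp_ideal (z : ℍ) {θ : ℂ} (hθ : ‖θ‖ = 1) : lor (toHyp z) (1, θ) =
    (1 / (toHyp z).1 + (toHyp z).1 * Complex.normSq (klein z - θ)) / 2 := by
  have hz := (toHyp_fst_pos z).ne'
  have h1 := lor_toHyp_self z
  have h2 : θ.re * θ.re + θ.im * θ.im = 1 := by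
    rw [← Complex.normSq_apply, Complex.normSq_eq_norm_sq, hθ, one_pow]
  rw [lor] at *
  simp only [klein, Complex.normSq_apply, Complex.sub_re, Complex.sub_im]
  field_simp
  linear_combination h1 - (toHyp z).1 ^ 2 * h2

theorem lor_toHyp_ideal_pos (z : ℍ) {θ : ℂ} (hθ : ‖θ‖ = 1) : 0 < lor (toHyp z) (1, θ) := by
  rw [lor_toHyp_ideal z hθ]
  have hz := toHyp_fst_pos z
  have := Complex.normSq_nonneg (klein z - θ)
  positivity

theorem lor_toHyp_ideal_le (z : ℍ) {θ : ℂ} (hθ : ‖θ‖ = 1) :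
    lor (toHyp z) (1, θ) ≤ 2 * (toHyp z).1 := by
  have hz := toHyp_fst_pos z
  have h1 := lor_toHyp_self z
  have h2 : θ.re * θ.re + θ.im * θ.im = 1 := by
    rw [← Complex.normSq_apply, Complex.normSq_eq_norm_sq, hθ, one_pow]
  rw [lor] at *
  simp only [mul_one]
  set p := (toHyp z).2.re
  set q := (toHyp z).2.im
  have h3 : (p * θ.re + q * θ.im) ^ 2 ≤ (toHyp z).1 ^ 2 := by
    have : (p * θ.re + q * θ.im) ^ 2 + (p * θ.im - q * θ.re) ^ 2 = p * p + q * q := by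
      linear_combination (p * p + q * q) * h2
    nlinarith [sq_nonneg (p * θ.im - q * θ.re)]
  have := abs_le_of_sq_le_sq' h3 hz.le
  linarith [this.1]

theorem lor_ideal_pos {θ η : ℂ} (hθ : ‖θ‖ = 1) (hη : ‖η‖ = 1) (h : θ ≠ η) :
    0 < lor (1, θ) (1, η) := by
  have h1 : θ.re * θ.re + θ.im * θ.im = 1 := by
    rw [← Complex.normSq_apply, Complex.normSq_eq_norm_sq, hθ, one_pow]
  have h2 : η.re * η.re + η.im * η.im = 1 := by
    rw [← Complex.normSq_apply, Complex.normSq_eq_norm_sq, hη, one_pow]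
  have h3 : 0 < Complex.normSq (θ - η) := Complex.normSq_pos.2 (sub_ne_zero.2 h)
  rw [Complex.normSq_apply, Complex.sub_re, Complex.sub_im] at h3
  rw [lor]
  simp only
  nlinarith

theorem lor_ideal_self {θ : ℂ} (hθ : ‖θ‖ = 1) : lor (1, θ) (1, θ) = 0 := by
  have h1 : θ.re * θ.re + θ.im * θ.im = 1 := by
    rw [← Complex.normSq_apply, Complex.normSq_eq_norm_sq, hθ, one_pow]
  rw [lor]
  simp only
  linarith

end Hyperboloid

/-! ### Geodesics as exponential curves, and their rigidity. -/

namespace Hyperboloid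

/-- A null vector orthogonal to a point of the hyperboloid vanishes. -/
theorem eq_zero_of_lor_eq_zero {q : ℝ × ℂ} (p : ℍ) (h : lor q q = 0) (hp : lor q (toHyp p) = 0) :
    q = 0 := by
  have h1 := lor_toHyp_self p
  rw [lor] at *
  set T := (toHyp p).1
  set x := (toHyp p).2.re
  set y := (toHyp p).2.im
  -- The form is negative definite on the orthogonal complement of a timelike vector. Lagrange's
  -- identity for the spatial parts of `q` and `toHyp p` makes this a vanishing sum of squares.
  have e : q.1 ^ 2 + (q.2.re * y - q.2.im * x) ^ 2 = 0 := by
    linear_combination (-q.1 ^ 2) * h1 + (T * q.1 + q.2.re * x + q.2.im * y) * hp - (x ^ 2 + y ^ 2) * h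
  have h0 : q.1 = 0 := by nlinarith [sq_nonneg q.1, sq_nonneg (q.2.re * y - q.2.im * x)]
  rw [h0] at h
  have hre : q.2.re = 0 := by nlinarith [mul_self_nonneg q.2.re, mul_self_nonneg q.2.im]
  have him : q.2.im = 0 := by nlinarith [mul_self_nonneg q.2.re, mul_self_nonneg q.2.im]
  exact Prod.ext h0 (Complex.ext hre him)

/-- Three points of a geodesic are linearly dependent in the hyperboloid model. -/
theorem sinh_smul_toHyp {u p q : ℍ} {r h : ℝ} (h1 : Real.cosh (dist u p) = Real.cosh r)
    (h2 : Real.cosh (dist u q) = Real.cosh (r - h)) (h3 : Real.cosh (dist p q) = Real.cosh h) :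
    Real.sinh h • toHyp u = Real.sinh (h - r) • toHyp p + Real.sinh r • toHyp q := by
  -- The defect `Q` of the interpolation formula is orthogonal to all three points, hence to itself,
  -- so it vanishes by `eq_zero_of_lor_eq_zero`.
  set Q := Real.sinh h • toHyp u - (Real.sinh (h - r) • toHyp p + Real.sinh r • toHyp q) with hQ
  have cs := Real.cosh_sq r
  have ch := Real.cosh_sq h
  have exp : ∀ w, lor Q w = Real.sinh h * lor (toHyp u) w -
      (Real.sinh (h - r) * lor (toHyp p) w + Real.sinh r * lor (toHyp q) w) := fun w => by
    rw [hQ, lor_sub_left, lor_add_left, lor_smul_left, lor_smul_left, lor_smul_left]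
  have hp : lor Q (toHyp p) = 0 := by
    rw [exp, lor_toHyp, lor_toHyp, lor_toHyp, dist_self, dist_comm q p, h1, h3, Real.sinh_sub,
      Real.cosh_zero]
    ring
  have hq : lor Q (toHyp q) = 0 := by
    rw [exp, lor_toHyp, lor_toHyp, lor_toHyp, dist_self, h2, h3, Real.sinh_sub, Real.cosh_sub,
      Real.cosh_zero]
    linear_combination (Real.sinh r) * ch
  have hu : lor Q (toHyp u) = 0 := by
    rw [exp, lor_toHyp, lor_toHyp, lor_toHyp, dist_self, dist_comm p u, dist_comm q u, h1, h2,
      Real.sinh_sub, Real.cosh_sub, Real.cosh_zero]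
    linear_combination -(Real.sinh h) * cs
  have h0 : lor Q Q = 0 := by
    rw [exp, lor_comm _ Q, lor_comm _ Q, lor_comm _ Q, hp, hq, hu]
    ring
  exact sub_eq_zero.1 (eq_zero_of_lor_eq_zero p h0 hp)

/-- A function which is locally a combination of `exp t` and `exp (-t)` is one globally. -/
theorem exists_eq_exp_of_locally {E : Type*} [NormedAddCommGroup E] [NormedSpace ℝ E] {u : ℝ → E}
    (h : ∀ x, ∃ a b : E, ∀ᶠ t in 𝓝 x, u t = Real.exp t • a + Real.exp (-t) • b) :
    ∃ a b : E, ∀ t, u t = Real.exp t • a + Real.exp (-t) • b := by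
  have hd : ∀ x, ∃ a b : E, ∀ᶠ t in 𝓝 x, u t = Real.exp t • a + Real.exp (-t) • b ∧
      deriv u t = Real.exp t • a - Real.exp (-t) • b := by
    intro x
    obtain ⟨a, b, hab⟩ := h x
    refine ⟨a, b, hab.eventually_nhds.mono fun t ht => ⟨ht.self_of_nhds, ?_⟩⟩
    have h1 : HasDerivAt (fun t : ℝ => Real.exp t • a + Real.exp (-t) • b)
        (Real.exp t • a + (Real.exp (-t) * (-1)) • b) t :=
      ((Real.hasDerivAt_exp t).smul_const a).add
        (((hasDerivAt_neg t).exp).smul_const b)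
    rw [(h1.congr_of_eventuallyEq ht).deriv]
    simp [sub_eq_add_neg]
  -- Locally, `exp (-t) • (u + u') = 2 • a` and `exp t • (u - u') = 2 • b`. These expressions do not
  -- mention the local coefficients, so connectedness of the line makes them global constants.
  have hA : IsLocallyConstant fun t => Real.exp (-t) • (u t + deriv u t) := by
    rw [IsLocallyConstant.iff_eventually_eq]
    intro x
    obtain ⟨a, b, hab⟩ := hd x
    have key : ∀ t, (u t = Real.exp t • a + Real.exp (-t) • b ∧
      deriv u t = Real.exp t • a - Real.exp (-t) • b) →
        Real.exp (-t) • (u t + deriv u t) = (2 : ℝ) • a := by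
      rintro t ⟨h1, h2⟩
      rw [h1, h2, show Real.exp t • a + Real.exp (-t) • b + (Real.exp t • a - Real.exp (-t) • b) =
        (2 * Real.exp t) • a by module, smul_smul]
      congr 1
      rw [mul_left_comm, ← Real.exp_add]; simp
    filter_upwards [hab] with t ht
    rw [key t ht, key x hab.self_of_nhds]
  have hB : IsLocallyConstant fun t => Real.exp t • (u t - deriv u t) := by
    rw [IsLocallyConstant.iff_eventually_eq]
    intro x
    obtain ⟨a, b, hab⟩ := hd x
    have key : ∀ t, (u t = Real.exp t • a + Real.exp (-t) • b ∧
      deriv u t = Real.exp t • a - Real.exp (-t) • b) →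
        Real.exp t • (u t - deriv u t) = (2 : ℝ) • b := by
      rintro t ⟨h1, h2⟩
      rw [h1, h2, show Real.exp t • a + Real.exp (-t) • b - (Real.exp t • a - Real.exp (-t) • b) =
        (2 * Real.exp (-t)) • b by module, smul_smul]
      congr 1
      rw [mul_left_comm, ← Real.exp_add]; simp
    filter_upwards [hab] with t ht
    rw [key t ht, key x hab.self_of_nhds]
  refine ⟨(2⁻¹ : ℝ) • (Real.exp (-0) • (u 0 + deriv u 0)),
    (2⁻¹ : ℝ) • (Real.exp 0 • (u 0 - deriv u 0)), fun t => ?_⟩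
  rw [hA.apply_eq_of_preconnectedSpace 0 t, hB.apply_eq_of_preconnectedSpace 0 t]
  have e : Real.exp t * Real.exp (-t) = 1 := by rw [← Real.exp_add]; simp
  have e' : Real.exp (-t) * Real.exp t = 1 := by rw [← Real.exp_add]; simp
  rw [smul_comm (Real.exp t), smul_comm (Real.exp (-t)), smul_smul (Real.exp t), e,
    smul_smul (Real.exp (-t)), e']
  module

/-- Geodesics of the hyperbolic plane, in the hyperboloid model. -/
theorem exists_toHyp_eq_of_isLocalIsometry {γ : ℝ → ℍ} (hγ : IsLocalIsometry γ) :
    ∃ a b : ℝ × ℂ, ∀ t, toHyp (γ t) = Real.exp t • a + Real.exp (-t) • b := by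
  apply exists_eq_exp_of_locally
  intro x
  obtain ⟨U, hU, hiso⟩ := hγ x
  obtain ⟨δ, hδ, hball⟩ := Metric.mem_nhds_iff.1 hU
  set h := δ / 2 with hh
  have h0 : 0 < h := by positivity
  have hx : x ∈ U := mem_of_mem_nhds hU
  have hxh : x + h ∈ U := hball (by
    rw [Metric.mem_ball, Real.dist_eq, add_sub_cancel_left, abs_of_pos h0]; linarith)
  have hs : Real.sinh h ≠ 0 := (Real.sinh_pos_iff.2 h0).ne'
  -- The coefficients of `exp t` and `exp (-t)` after expanding the two hyperbolic sines in
  -- `sinh_smul_toHyp`, with `r = t - x`.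
  refine ⟨(2 * Real.sinh h)⁻¹ • (Real.exp (-x) • toHyp (γ (x + h)) -
      Real.exp (-(h + x)) • toHyp (γ x)),
    (2 * Real.sinh h)⁻¹ • (Real.exp (h + x) • toHyp (γ x) - Real.exp x • toHyp (γ (x + h))), ?_⟩
  filter_upwards [hU] with t ht
  have key := sinh_smul_toHyp (u := γ t) (p := γ x) (q := γ (x + h)) (r := t - x) (h := h)
    (by rw [hiso t ht x hx, Real.dist_eq, Real.cosh_abs])
    (by rw [hiso t ht _ hxh, Real.dist_eq, Real.cosh_abs]; congr 1; ring)
    (by rw [hiso x hx _ hxh, Real.dist_eq, Real.cosh_abs, ← Real.cosh_neg]; congr 1; ring)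
  rw [← smul_right_injective _ hs |>.eq_iff, key]
  rw [Real.sinh_eq (h - (t - x)), Real.sinh_eq (t - x)]
  rw [show h - (t - x) = -t + (h + x) by ring, show t - x = t + -x by ring,
    show -(-t + (h + x)) = t + -(h + x) by ring, show -(t + -x) = -t + x by ring]
  have hc : Real.sinh h * (2 * Real.sinh h)⁻¹ = 1 / 2 := by field_simp
  generalize (2 * Real.sinh h)⁻¹ = c at hc ⊢
  generalize Real.sinh h = k at hc ⊢
  simp only [Real.exp_add]
  match_scalars
  · linear_combination (Real.exp t * Real.exp (-(h + x)) -
      Real.exp (-t) * (Real.exp h * Real.exp x)) * hc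
  · linear_combination (Real.exp (-t) * Real.exp x - Real.exp t * Real.exp (-x)) * hc

/-- The coefficients of a geodesic are null vectors of the future light cone. -/
structure IsGeodesicPair (a b : ℝ × ℂ) : Prop where
  null_left : lor a a = 0
  null_right : lor b b = 0
  two_mul_lor : 2 * lor a b = 1
  pos_left : 0 < a.1
  pos_right : 0 < b.1

/-- The self-product of the curve is a Laurent polynomial in `exp (2 * t)` equal to `1`; the times
`0` and `±log 2` suffice to read off its three coefficients. If `a.1 * b.1 ≤ 0`, Cauchy–Schwarz
would make `lor a b` nonpositive; the common sign is that of the time coordinate at `t = 0`. -/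
theorem isGeodesicPair_of_toHyp_eq {γ : ℝ → ℍ} {a b : ℝ × ℂ}
    (h : ∀ t, toHyp (γ t) = Real.exp t • a + Real.exp (-t) • b) : IsGeodesicPair a b := by
  have key : ∀ t, Real.exp t * Real.exp t * lor a a + 2 * lor a b +
      Real.exp (-t) * Real.exp (-t) * lor b b = 1 := fun t => by
    have e : Real.exp t * Real.exp (-t) = 1 := by rw [← Real.exp_add]; simp
    have := lor_toHyp_self (γ t)
    rw [h, lor_add_left, lor_add_right, lor_add_right, lor_smul_left, lor_smul_left, lor_smul_left,
      lor_smul_left, lor_smul_right, lor_smul_right, lor_smul_right, lor_smul_right,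
      lor_comm b a] at this
    linear_combination this - 2 * lor a b * e
  have k0 := key 0
  have k1 := key (Real.log 2)
  have k2 := key (-Real.log 2)
  rw [neg_neg] at k2
  rw [Real.exp_neg, Real.exp_log two_pos] at k1 k2
  rw [neg_zero, Real.exp_zero] at k0
  norm_num at k0 k1 k2
  have ha : lor a a = 0 := by linarith
  have hb : lor b b = 0 := by linarith
  have hab : 2 * lor a b = 1 := by linarith
  have hsum : 0 < a.1 + b.1 := by
    have := toHyp_fst_pos (γ 0)
    rw [h 0] at this
    simpa using this
  have hprod : 0 < a.1 * b.1 := by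
    by_contra hle
    rw [lor] at ha hb hab
    have h1 : (a.2.re * b.2.re + a.2.im * b.2.im) ^ 2 ≤ (a.1 * b.1) ^ 2 := by
      have : (a.2.re * b.2.re + a.2.im * b.2.im) ^ 2 + (a.2.re * b.2.im - a.2.im * b.2.re) ^ 2 =
          (a.1 * b.1) ^ 2 := by
        linear_combination (-b.1 ^ 2) * ha - (a.2.re ^ 2 + a.2.im ^ 2) * hb
      nlinarith [sq_nonneg (a.2.re * b.2.im - a.2.im * b.2.re)]
    have h2 := sq_le_sq.1 h1
    rw [abs_of_nonpos (not_lt.1 hle)] at h2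
    have := neg_abs_le (a.2.re * b.2.re + a.2.im * b.2.im)
    linarith
  rcases pos_and_pos_or_neg_and_neg_of_mul_pos hprod with hp | hn
  · exact ⟨ha, hb, hab, hp.1, hp.2⟩
  · linarith [hn.1, hn.2]

/-- Geodesics of the hyperbolic plane minimize the distance. -/
theorem isometry_of_isLocalIsometry {γ : ℝ → ℍ} (hγ : IsLocalIsometry γ) : Isometry γ := by
  obtain ⟨a, b, e⟩ := exists_toHyp_eq_of_isLocalIsometry hγ
  have p := isGeodesicPair_of_toHyp_eq e
  refine Isometry.of_dist_eq fun s t => ?_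
  have h : Real.cosh (dist (γ s) (γ t)) = Real.cosh (dist s t) := by
    have h2 := p.two_mul_lor
    rw [← lor_toHyp, e, e, Real.dist_eq, Real.cosh_abs]
    simp only [lor_add_left, lor_add_right, lor_smul_left, lor_smul_right, p.null_left,
      p.null_right, lor_comm b a]
    rw [Real.cosh_eq, neg_sub, sub_eq_add_neg, sub_eq_add_neg, Real.exp_add, Real.exp_add]
    linear_combination (Real.exp s * Real.exp (-t) + Real.exp t * Real.exp (-s)) / 2 * h2
  exact eq_of_cosh_eq dist_nonneg dist_nonneg h

/-- Two vectors of the future light cone whose product is not positive are parallel. -/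
theorem exists_smul_eq_of_lor_nonpos {a b : ℝ × ℂ} (ha : lor a a = 0) (hb : lor b b = 0)
    (ha0 : 0 < a.1) (hb0 : 0 < b.1) (h : lor a b ≤ 0) : ∃ r : ℝ, 0 < r ∧ b = r • a := by
  rw [lor] at ha hb h
  have h1 : (b.1 * a.2.re - a.1 * b.2.re) ^ 2 + (b.1 * a.2.im - a.1 * b.2.im) ^ 2 =
      2 * (a.1 * b.1) * (a.1 * b.1 - a.2.re * b.2.re - a.2.im * b.2.im) := by
    linear_combination (-b.1 ^ 2) * ha - a.1 ^ 2 * hb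
  have h2 : 2 * (a.1 * b.1) * (a.1 * b.1 - a.2.re * b.2.re - a.2.im * b.2.im) ≤ 0 :=
    mul_nonpos_of_nonneg_of_nonpos (by positivity) h
  have hre : b.1 * a.2.re - a.1 * b.2.re = 0 := by
    nlinarith [sq_nonneg (b.1 * a.2.re - a.1 * b.2.re), sq_nonneg (b.1 * a.2.im - a.1 * b.2.im)]
  have him : b.1 * a.2.im - a.1 * b.2.im = 0 := by
    nlinarith [sq_nonneg (b.1 * a.2.re - a.1 * b.2.re), sq_nonneg (b.1 * a.2.im - a.1 * b.2.im)]
  refine ⟨b.1 / a.1, by positivity, Prod.ext ?_ (Complex.ext ?_ ?_)⟩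
  · simp; field_simp
  · simp; field_simp; linarith
  · simp; field_simp; linarith

/-- A positive `A` would force `d n` to grow like `2nv`. Concretely, `d n < n * v` eventually, and
multiplying by `exp (-(2 * (n * v)))` bounds `A + o(1)` by `exp (-(n * v))`. -/
theorem nonpos_of_cosh_eq {v A B C : ℝ} (hv : 0 < v) {d : ℕ → ℝ}
    (hd : Tendsto (fun n : ℕ => d n / n) atTop (𝓝 0)) (hd0 : ∀ n, 0 ≤ d n)
    (h : ∀ n : ℕ, Real.cosh (d n) = Real.exp (2 * (n * v)) * A + B +
      Real.exp (-(2 * (n * v))) * C) : A ≤ 0 := by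
  have hle : ∀ᶠ n : ℕ in atTop, A + Real.exp (-(2 * (n * v))) * B +
      Real.exp (-(2 * (n * v))) * Real.exp (-(2 * (n * v))) * C ≤ Real.exp (-(n * v)) := by
    filter_upwards [hd.eventually (gt_mem_nhds hv), eventually_gt_atTop 0] with n hn hn0
    have hn1 : (0 : ℝ) < n := by exact_mod_cast hn0
    rw [div_lt_iff₀ hn1] at hn
    have h1 : Real.cosh (d n) ≤ Real.exp (n * v) := by
      refine le_trans ?_ (Real.exp_le_exp.2 (by linarith : d n ≤ n * v))
      rw [Real.cosh_eq]
      have : Real.exp (-d n) ≤ Real.exp (d n) := Real.exp_le_exp.2 (by linarith [hd0 n])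
      linarith
    have h2 : Real.exp (-(n * v)) = Real.exp (-(2 * (n * v))) * Real.exp (n * v) := by
      rw [← Real.exp_add]; congr 1; ring
    have h3 : Real.exp (-(2 * (n * v))) * Real.exp (2 * (n * v)) = 1 := by
      rw [← Real.exp_add]; simp
    rw [h2]
    calc _ = Real.exp (-(2 * (n * v))) * Real.cosh (d n) := by
          rw [h]; linear_combination (-A) * h3
      _ ≤ _ := by gcongr
  have t0 : Tendsto (fun n : ℕ => (n : ℝ) * v) atTop atTop :=
    tendsto_natCast_atTop_atTop.atTop_mul_const hv
  have t1 : Tendsto (fun n : ℕ => Real.exp (-(n * v))) atTop (𝓝 0) :=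
    Real.tendsto_exp_neg_atTop_nhds_zero.comp t0
  have t2 : Tendsto (fun n : ℕ => Real.exp (-(2 * (n * v)))) atTop (𝓝 0) :=
    Real.tendsto_exp_neg_atTop_nhds_zero.comp (t0.const_mul_atTop two_pos)
  have t3 := (tendsto_const_nhds (x := A)).add (t2.mul_const B) |>.add ((t2.mul t2).mul_const C)
  simpa using le_of_tendsto_of_tendsto t3 t1 hle

theorem lor_toHyp_pos {a : ℝ × ℂ} (z : ℍ) (ha : lor a a = 0) (ha0 : 0 < a.1) :
    0 < lor (toHyp z) a := by
  have hθ : ‖(⟨a.2.re / a.1, a.2.im / a.1⟩ : ℂ)‖ = 1 := by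
    rw [← sq_eq_sq₀ (norm_nonneg _) zero_le_one, ← Complex.normSq_eq_norm_sq, Complex.normSq_apply]
    rw [lor] at ha
    field_simp
    linarith
  have e : a = a.1 • ((1, ⟨a.2.re / a.1, a.2.im / a.1⟩) : ℝ × ℂ) := by
    refine Prod.ext ?_ (Complex.ext ?_ ?_) <;> simp <;> field_simp
  rw [e, lor_smul_right]
  exact mul_pos ha0 (lor_toHyp_ideal_pos z hθ)

/-- Two geodesics at sublinear distance differ by a translation of the time. -/
theorem exists_translate_of_sublinear {γ₁ γ₂ : ℝ → ℍ} (h₁ : IsLocalIsometry γ₁)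
    (h₂ : IsLocalIsometry γ₂) {v : ℝ} (hv : 0 < v)
    (hf : Tendsto (fun n : ℕ => dist (γ₁ (n * v)) (γ₂ (n * v)) / n) atTop (𝓝 0))
    (hb : Tendsto (fun n : ℕ => dist (γ₁ (-(n * v))) (γ₂ (-(n * v))) / n) atTop (𝓝 0)) :
    ∃ s : ℝ, ∀ t, γ₂ t = γ₁ (t + s) := by
  obtain ⟨a, b, e⟩ := exists_toHyp_eq_of_isLocalIsometry h₁
  obtain ⟨a', b', e'⟩ := exists_toHyp_eq_of_isLocalIsometry h₂
  have p := isGeodesicPair_of_toHyp_eq e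
  have p' := isGeodesicPair_of_toHyp_eq e'
  have key : ∀ t, Real.cosh (dist (γ₁ t) (γ₂ t)) = Real.exp (2 * t) * lor a a' +
      (lor a b' + lor b a') + Real.exp (-(2 * t)) * lor b b' := fun t => by
    have h0 : Real.exp t * Real.exp (-t) = 1 := by rw [← Real.exp_add]; simp
    have h1 : Real.exp (2 * t) = Real.exp t * Real.exp t := by rw [← Real.exp_add]; congr 1; ring
    have h2 : Real.exp (-(2 * t)) = Real.exp (-t) * Real.exp (-t) := by
      rw [← Real.exp_add]; congr 1; ring
    rw [← lor_toHyp, e, e', lor_add_left, lor_add_right, lor_add_right, lor_smul_left,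
      lor_smul_left, lor_smul_left, lor_smul_left, lor_smul_right, lor_smul_right, lor_smul_right,
      lor_smul_right, h1, h2]
    linear_combination (lor a b' + lor b a') * h0
  have hA : lor a a' ≤ 0 := nonpos_of_cosh_eq hv hf (fun _ => dist_nonneg) fun n => key _
  have hB : lor b b' ≤ 0 := nonpos_of_cosh_eq (C := lor a a') (B := lor a b' + lor b a') hv hb
    (fun _ => dist_nonneg) fun n => by rw [key]; simp only [mul_neg, neg_neg]; ring
  obtain ⟨r, hr, rfl⟩ := exists_smul_eq_of_lor_nonpos p.null_left p'.null_left p.pos_left p'.pos_left hA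
  obtain ⟨q, hq, rfl⟩ :=
    exists_smul_eq_of_lor_nonpos p.null_right p'.null_right p.pos_right p'.pos_right hB
  -- The normalization `2 * lor a b = 1` of both pairs makes the two scaling factors inverse to each
  -- other, which is exactly the effect of shifting the time by `log r`.
  have hrq : r * q = 1 := by
    have h1 := p.two_mul_lor
    have h2 := p'.two_mul_lor
    rw [lor_smul_left, lor_smul_right] at h2
    linear_combination h2 - r * q * h1
  refine ⟨Real.log r, fun t => toHyp_injective ?_⟩
  rw [e, e', neg_add, Real.exp_add, Real.exp_add, Real.exp_neg (Real.log r), Real.exp_log hr,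
    eq_comm, ← eq_inv_of_mul_eq_one_right hrq, smul_smul, smul_smul]

theorem coeff_eq_of_forall_le {α β : ℝ}
    (h : ∀ t : ℝ, α + β ≤ Real.exp t * α + Real.exp (-t) * β) : α = β := by
  have hd : HasDerivAt (fun t : ℝ => Real.exp t * α + Real.exp (-t) * β)
      (Real.exp 0 * α + Real.exp (-0) * (-1) * β) 0 :=
    ((Real.hasDerivAt_exp 0).mul_const α).add (((hasDerivAt_neg (0 : ℝ)).exp).mul_const β)
  have hm : IsLocalMin (fun t : ℝ => Real.exp t * α + Real.exp (-t) * β) 0 :=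
    Eventually.of_forall fun t => by simpa using h t
  have := hm.hasDerivAt_eq_zero hd
  simp at this
  linarith

/-- A geodesic is determined by its ends and by the fact that the time `0` is that of a point
closest to a given point. -/
theorem eq_of_sublinear_of_isMin {γ₁ γ₂ : ℝ → ℍ} (h₁ : IsLocalIsometry γ₁)
    (h₂ : IsLocalIsometry γ₂) {v : ℝ} (hv : 0 < v)
    (hf : Tendsto (fun n : ℕ => dist (γ₁ (n * v)) (γ₂ (n * v)) / n) atTop (𝓝 0))
    (hb : Tendsto (fun n : ℕ => dist (γ₁ (-(n * v))) (γ₂ (-(n * v))) / n) atTop (𝓝 0)) {z : ℍ}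
    (m₁ : ∀ t, dist z (γ₁ 0) ≤ dist z (γ₁ t)) (m₂ : ∀ t, dist z (γ₂ 0) ≤ dist z (γ₂ t)) :
    γ₁ = γ₂ := by
  obtain ⟨s, hs⟩ := exists_translate_of_sublinear h₁ h₂ hv hf hb
  obtain ⟨a, b, e⟩ := exists_toHyp_eq_of_isLocalIsometry h₁
  have p := isGeodesicPair_of_toHyp_eq e
  set α := lor (toHyp z) a
  set β := lor (toHyp z) b
  have hα : 0 < α := lor_toHyp_pos z p.null_left p.pos_left
  have key : ∀ t, Real.cosh (dist z (γ₁ t)) = Real.exp t * α + Real.exp (-t) * β := fun t => by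
    rw [← lor_toHyp, e, lor_add_right, lor_smul_right, lor_smul_right]
  have mono : ∀ {x y : ℍ}, dist z x ≤ dist z y → Real.cosh (dist z x) ≤ Real.cosh (dist z y) :=
    fun h => by rwa [Real.cosh_le_cosh, abs_of_nonneg dist_nonneg, abs_of_nonneg dist_nonneg]
  -- The minimum of `exp t * α + exp (-t) * β` is at `0` only if `α = β`. For the shifted geodesic
  -- the coefficients are `exp s * α` and `exp (-s) * β`, so both conditions force `s = 0`.
  have c1 : α = β := coeff_eq_of_forall_le fun t => by
    have := mono (m₁ t)
    rw [key, key] at this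
    simpa using this
  have c2 : Real.exp s * α = Real.exp (-s) * β := coeff_eq_of_forall_le fun t => by
    have := mono (m₂ t)
    rw [hs, hs, key, key, zero_add, neg_add, Real.exp_add, Real.exp_add] at this
    linarith
  rw [← c1] at c2
  have c3 := Real.exp_injective (mul_right_cancel₀ hα.ne' c2)
  have c4 : s = 0 := by linarith
  funext t
  rw [hs, c4, add_zero]

end Hyperboloid

/-! ### Subexponential growth and convergence to infinity. -/

namespace Hyperboloid

/-- The sequence `u` is bounded above by `exp (ε n)`, eventually, for every `ε > 0`. -/
def SubExp (u : ℕ → ℝ) : Prop := ∀ ε > 0, ∀ᶠ n : ℕ in atTop, u n ≤ Real.exp (ε * n)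

namespace SubExp

theorem mono {u w : ℕ → ℝ} (hw : SubExp w) (h : ∀ n, u n ≤ w n) : SubExp u := fun ε hε =>
  (hw ε hε).mono fun n hn => (h n).trans hn

theorem mul {u w : ℕ → ℝ} (hu : SubExp u) (hw : SubExp w) (hw0 : ∀ n, 0 ≤ w n) :
    SubExp fun n => u n * w n := fun ε hε => by
  filter_upwards [hu (ε / 2) (by positivity), hw (ε / 2) (by positivity)] with n h1 h2
  calc u n * w n ≤ Real.exp (ε / 2 * n) * Real.exp (ε / 2 * n) :=
        mul_le_mul h1 h2 (hw0 n) (Real.exp_pos _).le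
    _ = _ := by rw [← Real.exp_add]; congr 1; ring

theorem const (C : ℝ) : SubExp fun _ => C := fun ε hε => by
  have : Tendsto (fun n : ℕ => Real.exp (ε * n)) atTop atTop :=
    Real.tendsto_exp_atTop.comp (tendsto_natCast_atTop_atTop.const_mul_atTop hε)
  exact this.eventually_ge_atTop C

theorem const_mul {u : ℕ → ℝ} (hu : SubExp u) {C : ℝ} (hC : 0 ≤ C) :
    SubExp fun n => C * u n := by
  simpa [mul_comm] using hu.mul (const C) fun _ => hC

theorem add {u w : ℕ → ℝ} (hu : SubExp u) (hw : SubExp w) : SubExp fun n => u n + w n :=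
  fun ε hε => by
  filter_upwards [hu (ε / 2) (by positivity), hw (ε / 2) (by positivity),
    const 2 (ε / 2) (by positivity)] with n h1 h2 h3
  have e : Real.exp (ε * n) = Real.exp (ε / 2 * n) * Real.exp (ε / 2 * n) := by
    rw [← Real.exp_add]; congr 1; ring
  rw [e]
  nlinarith [Real.exp_pos (ε / 2 * n)]

theorem tendsto_div_of_cosh {d : ℕ → ℝ} (hd : SubExp fun n => Real.cosh (d n))
    (h0 : ∀ n, 0 ≤ d n) : Tendsto (fun n : ℕ => d n / n) atTop (𝓝 0) := by
  have h2 : SubExp fun n => Real.exp (d n) :=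
    (hd.const_mul zero_le_two).mono fun n => by
      rw [Real.cosh_eq]; linarith [Real.exp_pos (-d n)]
  rw [tendsto_order]
  refine ⟨fun a ha => Eventually.of_forall fun n =>
    ha.trans_le (div_nonneg (h0 n) n.cast_nonneg), fun a ha => ?_⟩
  filter_upwards [h2 (a / 2) (by positivity), eventually_gt_atTop 0] with n hn hn0
  have hn1 : (0 : ℝ) < n := by exact_mod_cast hn0
  rw [div_lt_iff₀ hn1]
  have := Real.exp_le_exp.1 hn
  nlinarith

end SubExp

section Direction

variable {w : ℕ → ℍ} {v : ℝ}

/-- With `subExp_exp_div_toHyp_fst` this says that the first coordinate is `exp (n * v)` up to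
subexponential factors both ways. -/
theorem subExp_exp_neg_mul_toHyp_fst
    (hv : Tendsto (fun n : ℕ => dist I (w n) / n) atTop (𝓝 v)) :
    SubExp fun n : ℕ => Real.exp (-(n * v)) * (toHyp (w n)).1 := fun ε hε => by
  filter_upwards [hv.eventually (gt_mem_nhds (show v < v + ε by linarith)),
    eventually_gt_atTop 0] with n hn hn0
  have hn1 : (0 : ℝ) < n := by exact_mod_cast hn0
  rw [div_lt_iff₀ hn1] at hn
  have h1 : (toHyp (w n)).1 ≤ Real.exp (dist I (w n)) := by
    rw [toHyp_fst, Real.cosh_eq]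
    have : Real.exp (-dist I (w n)) ≤ Real.exp (dist I (w n)) :=
      Real.exp_le_exp.2 (by linarith [dist_nonneg (x := I) (y := w n)])
    linarith
  calc _ ≤ Real.exp (-(n * v)) * Real.exp ((v + ε) * n) := by
        gcongr; exact h1.trans (Real.exp_le_exp.2 hn.le)
    _ = _ := by rw [← Real.exp_add]; congr 1; ring

theorem subExp_exp_div_toHyp_fst
    (hv : Tendsto (fun n : ℕ => dist I (w n) / n) atTop (𝓝 v)) :
    SubExp fun n : ℕ => Real.exp (n * v) * (1 / (toHyp (w n)).1) := by
  have key : SubExp fun n : ℕ => Real.exp (n * v) * Real.exp (-dist I (w n)) := fun ε hε => by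
    filter_upwards [hv.eventually (lt_mem_nhds (show v - ε < v by linarith)),
      eventually_gt_atTop 0] with n hn hn0
    have hn1 : (0 : ℝ) < n := by exact_mod_cast hn0
    rw [lt_div_iff₀ hn1] at hn
    rw [← Real.exp_add]
    exact Real.exp_le_exp.2 (by linarith)
  refine (key.const_mul zero_le_two).mono fun n => ?_
  have h1 : 1 / (toHyp (w n)).1 ≤ 2 * Real.exp (-dist I (w n)) := by
    rw [div_le_iff₀ (toHyp_fst_pos _), toHyp_fst, Real.cosh_eq]
    have h2 : Real.exp (-dist I (w n)) * Real.exp (dist I (w n)) = 1 := by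
      rw [← Real.exp_add]; simp
    nlinarith [Real.exp_pos (-dist I (w n))]
  calc _ ≤ Real.exp (n * v) * (2 * Real.exp (-dist I (w n))) := by gcongr
    _ = _ := by ring

/-- Sublinear tracking: a sequence of bounded jumps which escapes at a positive speed converges at
infinity, and exponentially fast. -/
theorem exists_direction {K : ℝ} (hK : ∀ n, dist (w n) (w (n + 1)) ≤ K) (hv0 : 0 < v)
    (hv : Tendsto (fun n : ℕ => dist I (w n) / n) atTop (𝓝 v)) :
    ∃ θ : ℂ, ‖θ‖ = 1 ∧ Tendsto (fun n => klein (w n)) atTop (𝓝 θ) ∧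
      SubExp fun n : ℕ => Real.exp (n * v) * lor (toHyp (w n)) (1, θ) := by
  have hinv := subExp_exp_div_toHyp_fst hv
  -- From `normSq_klein_sub` without its negative terms: the squared Klein jump is at most `2 cosh
  -- K` over the product of the two heights.
  set D := Real.sqrt (2 * Real.cosh K) with hD
  have step : ∀ ε > 0, ε < v → ∃ N, ∀ n ≥ N,
      dist (klein (w n)) (klein (w (n + 1))) ≤ D * Real.exp (-(v - ε)) ^ n ∧
        1 / (toHyp (w n)).1 ≤ Real.exp (-(v - ε)) ^ n := by
    intro ε hε hεv
    obtain ⟨N, hN⟩ := eventually_atTop.1 (hinv ε hε)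
    have h1 : ∀ n ≥ N, 1 / (toHyp (w n)).1 ≤ Real.exp (-(v - ε)) ^ n := fun n hn => by
      have := hN n hn
      rw [← Real.exp_nat_mul, show (n : ℝ) * -(v - ε) = -(n * v) + ε * n by ring, Real.exp_add]
      calc 1 / (toHyp (w n)).1 = Real.exp (-(n * v)) *
            (Real.exp (n * v) * (1 / (toHyp (w n)).1)) := by
              rw [← mul_assoc, ← Real.exp_add]; simp
        _ ≤ _ := by gcongr
    refine ⟨N, fun n hn => ⟨?_, h1 n hn⟩⟩
    set r := Real.exp (-(v - ε)) with hr
    have hr0 : 0 < r := Real.exp_pos _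
    have hr1 : r ≤ 1 := Real.exp_le_one_iff.2 (by linarith)
    have h2 : 1 / (toHyp (w (n + 1))).1 ≤ r ^ n :=
      (h1 _ (by omega)).trans (pow_le_pow_of_le_one hr0.le hr1 (by omega))
    have h3 : Real.cosh (dist (w n) (w (n + 1))) ≤ Real.cosh K := by
      rw [Real.cosh_le_cosh, abs_of_nonneg dist_nonneg]
      exact (hK n).trans (le_abs_self K)
    have hp := toHyp_fst_pos (w n)
    have hp' := toHyp_fst_pos (w (n + 1))
    rw [dist_eq_norm]
    refine abs_le_of_sq_le_sq' ?_ (by positivity) |>.2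
    rw [← Complex.normSq_eq_norm_sq, normSq_klein_sub, mul_pow, hD,
      Real.sq_sqrt (by have := Real.cosh_pos K; positivity)]
    calc _ ≤ 2 * Real.cosh (dist (w n) (w (n + 1))) /
          ((toHyp (w n)).1 * (toHyp (w (n + 1))).1) := by
          have : 0 ≤ 1 / (toHyp (w n)).1 ^ 2 := by positivity
          have : 0 ≤ 1 / (toHyp (w (n + 1))).1 ^ 2 := by positivity
          linarith
      _ = 2 * Real.cosh (dist (w n) (w (n + 1))) *
          ((1 / (toHyp (w n)).1) * (1 / (toHyp (w (n + 1))).1)) := by field_simp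
      _ ≤ 2 * Real.cosh K * (r ^ n * r ^ n) := by
          have := Real.cosh_pos K
          gcongr
          exact h1 n hn
      _ = _ := by ring
  have geom : ∀ ε > 0, ε < v → ∃ N, ∀ n, dist (klein (w (N + n))) (klein (w (N + (n + 1)))) ≤
      D * Real.exp (-(v - ε)) ^ N * Real.exp (-(v - ε)) ^ n := by
    intro ε hε hεv
    obtain ⟨N, hN⟩ := step ε hε hεv
    refine ⟨N, fun n => ((hN (N + n) (by omega)).1).trans (le_of_eq ?_)⟩
    rw [pow_add, mul_assoc]
  have hlt : ∀ ε, ε < v → Real.exp (-(v - ε)) < 1 := fun ε h =>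
    Real.exp_lt_one_iff.2 (by linarith)
  obtain ⟨N, hN⟩ := geom (v / 2) (by positivity) (by linarith)
  obtain ⟨θ, hθ⟩ := cauchySeq_tendsto_of_complete
    (cauchySeq_of_le_geometric _ _ (hlt _ (by linarith)) hN)
  have hθ' : Tendsto (fun n => klein (w n)) atTop (𝓝 θ) := by
    refine (tendsto_add_atTop_iff_nat N).1 ?_
    simpa only [add_comm] using hθ
  have hinv0 : Tendsto (fun n => 1 / (toHyp (w n)).1) atTop (𝓝 0) := by
    obtain ⟨M, hM⟩ := step (v / 2) (by positivity) (by linarith)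
    refine squeeze_zero' (Eventually.of_forall fun n => ?_)
      (eventually_atTop.2 ⟨M, fun n hn => (hM n hn).2⟩)
      (tendsto_pow_atTop_nhds_zero_of_lt_one (Real.exp_pos _).le (hlt _ (by linarith)))
    have := toHyp_fst_pos (w n)
    positivity
  have hnorm : ‖θ‖ = 1 := by
    have t1 : Tendsto (fun n => Complex.normSq (klein (w n))) atTop (𝓝 (Complex.normSq θ)) :=
      (Complex.continuous_normSq.tendsto θ).comp hθ'
    have t2 : Tendsto (fun n => Complex.normSq (klein (w n))) atTop (𝓝 (1 - 0 ^ 2)) := by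
      simp only [normSq_klein]
      simpa only [one_div, inv_pow] using (hinv0.pow 2).const_sub 1
    have := tendsto_nhds_unique t1 t2
    rw [Complex.normSq_eq_norm_sq, zero_pow two_ne_zero, sub_zero] at this
    exact (pow_eq_one_iff_of_nonneg (norm_nonneg _) two_ne_zero).1 this
  have hdist : SubExp fun n : ℕ => Real.exp (n * v) * dist (klein (w n)) θ := by
    intro ε hε
    -- The cap `v / 2` keeps the ratio of the geometric series below `1`; `ε / 2` leaves room for
    -- absorbing the constant `D / (1 - r)`.
    set ε' := min (ε / 2) (v / 2) with hε'
    have hε0 : 0 < ε' := by positivity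
    have hεv : ε' < v := (min_le_right _ _).trans_lt (by linarith)
    obtain ⟨M, hM⟩ := geom ε' hε0 hεv
    set r := Real.exp (-(v - ε')) with hr
    have hb : ∀ n, dist (klein (w (M + n))) θ ≤ D * r ^ M * r ^ n / (1 - r) := fun n =>
      dist_le_of_le_geometric_of_tendsto r (D * r ^ M) (hlt _ hεv) hM
        (by simpa only [add_comm] using (tendsto_add_atTop_iff_nat M).2 hθ') n
    filter_upwards [SubExp.const (D / (1 - r)) (ε / 2) (by positivity),
      eventually_ge_atTop M] with n h1 h2
    obtain ⟨m, rfl⟩ := Nat.exists_eq_add_of_le h2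
    have h3 : D * r ^ M * r ^ m / (1 - r) = Real.exp (-((M + m : ℕ) * (v - ε'))) * (D / (1 - r)) := by
      rw [mul_assoc, ← pow_add, hr, ← Real.exp_nat_mul]; ring_nf
    calc _ ≤ Real.exp ((M + m : ℕ) * v) *
          (Real.exp (-((M + m : ℕ) * (v - ε'))) * Real.exp (ε / 2 * (M + m : ℕ))) := by
          refine mul_le_mul_of_nonneg_left ((hb m).trans ?_) (Real.exp_pos _).le
          rw [h3]; gcongr
      _ = Real.exp ((ε' + ε / 2) * (M + m : ℕ)) := by
          rw [← Real.exp_add, ← Real.exp_add]; congr 1; ring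
      _ ≤ _ := by
          gcongr
          linarith [min_le_left (ε / 2) (v / 2)]
  refine ⟨θ, hnorm, hθ', ?_⟩
  -- In `lor_toHyp_ideal` multiplied by `exp (n * v)`, the second term is `exp (-(n * v))` times the
  -- height times the square of `exp (n * v) * dist (klein (w n)) θ`, so every factor is
  -- subexponential.
  have hlor := ((hinv.add (((subExp_exp_neg_mul_toHyp_fst hv).mul hdist fun n => by positivity).mul
    hdist fun n => by positivity)).const_mul (C := 1 / 2) (by norm_num))
  refine hlor.mono fun n => le_of_eq ?_
  have e : Real.exp (-(n * v)) * Real.exp (n * v) = 1 := by rw [← Real.exp_add]; simp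
  rw [lor_toHyp_ideal _ hnorm, Complex.normSq_eq_norm_sq, dist_eq_norm]
  linear_combination (-1 / 2 * (toHyp (w n)).1 * Real.exp (n * v) * ‖klein (w n) - θ‖ ^ 2) * e

/-- Two sequences which escape in the same direction at the same speed stay at sublinear
distance. -/
theorem tendsto_dist_div_of_same_direction {w' : ℕ → ℍ} {θ : ℂ} (hθ : ‖θ‖ = 1)
    (hv : Tendsto (fun n : ℕ => dist I (w n) / n) atTop (𝓝 v))
    (hv' : Tendsto (fun n : ℕ => dist I (w' n) / n) atTop (𝓝 v))
    (h : SubExp fun n : ℕ => Real.exp (n * v) * lor (toHyp (w n)) (1, θ))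
    (h' : SubExp fun n : ℕ => Real.exp (n * v) * lor (toHyp (w' n)) (1, θ)) :
    Tendsto (fun n : ℕ => dist (w n) (w' n) / n) atTop (𝓝 0) := by
  refine SubExp.tendsto_div_of_cosh (SubExp.mono (((h.mul (subExp_exp_neg_mul_toHyp_fst hv')
    fun n => mul_nonneg (Real.exp_pos _).le (toHyp_fst_pos _).le).add
    (h'.mul (subExp_exp_neg_mul_toHyp_fst hv)
    fun n => mul_nonneg (Real.exp_pos _).le (toHyp_fst_pos _).le)).const_mul zero_le_two)
    fun n => ?_) fun _ => dist_nonneg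
  have e : Real.exp (n * v) * Real.exp (-(n * v)) = 1 := by rw [← Real.exp_add]; simp
  have hp := toHyp_fst_pos (w n)
  have hp' := toHyp_fst_pos (w' n)
  have h1 := normSq_klein_sub (w n) (w' n)
  -- Passing through the common end `θ` bounds `cosh (dist (w n) (w' n))` by products of one
  -- Busemann term and one height, whose weights `exp (n * v)` and `exp (-(n * v))` cancel.
  have h2 : Complex.normSq (klein (w n) - klein (w' n)) ≤
      2 * Complex.normSq (klein (w n) - θ) + 2 * Complex.normSq (klein (w' n) - θ) := by
    simp only [Complex.normSq_apply, Complex.sub_re, Complex.sub_im]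
    nlinarith [sq_nonneg ((klein (w n)).re + (klein (w' n)).re - 2 * θ.re),
      sq_nonneg ((klein (w n)).im + (klein (w' n)).im - 2 * θ.im)]
  have e1 := lor_toHyp_ideal (w n) hθ
  have e2 := lor_toHyp_ideal (w' n) hθ
  set T := (toHyp (w n)).1
  set T' := (toHyp (w' n)).1
  set p := Complex.normSq (klein (w n) - θ)
  set q := Complex.normSq (klein (w' n) - θ)
  have h3 : Real.cosh (dist (w n) (w' n)) = T * T' / 2 *
      (Complex.normSq (klein (w n) - klein (w' n)) + 1 / T ^ 2 + 1 / T' ^ 2) := by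
    rw [h1]; field_simp; ring
  calc _ ≤ T * T' / 2 * (2 * p + 2 * q + 1 / T ^ 2 + 1 / T' ^ 2) := by
        rw [h3]; gcongr
    _ ≤ 2 * (lor (toHyp (w n)) (1, θ) * T' + lor (toHyp (w' n)) (1, θ) * T) := by
        rw [e1, e2]
        have h4 : 2 * ((1 / T + T * p) / 2 * T' + (1 / T' + T' * q) / 2 * T) =
          T * T' / 2 * (2 * p + 2 * q + 2 * (1 / T ^ 2) + 2 * (1 / T' ^ 2)) := by field_simp; ring
        rw [h4]
        have : 0 ≤ 1 / T ^ 2 := by positivity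
        have : 0 ≤ 1 / T' ^ 2 := by positivity
        gcongr <;> linarith
    _ = _ := by
        linear_combination (-2 * (lor (toHyp (w n)) (1, θ) * T' + lor (toHyp (w' n)) (1, θ) * T)) * e

end Direction

end Hyperboloid

/-! ### The geodesic with given ends, based at the projection of a given point. -/

namespace Hyperboloid

/-- A point of the hyperbolic plane and two distinct points at infinity, in the Klein model. -/
def AxisData : Type := {p : ℍ × ℂ × ℂ // ‖p.2.1‖ = 1 ∧ ‖p.2.2‖ = 1 ∧ p.2.1 ≠ p.2.2}

noncomputable instance : TopologicalSpace AxisData := instTopologicalSpaceSubtype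

noncomputable instance : MeasurableSpace AxisData := Subtype.instMeasurableSpace

instance : BorelSpace AxisData := Subtype.borelSpace _

namespace AxisData

variable (p : AxisData)

/-- Half of the hyperbolic cosine of the distance from the point to its projection. -/
noncomputable def scale : ℝ :=
  Real.sqrt (lor (toHyp p.1.1) (1, p.1.2.1) * lor (toHyp p.1.1) (1, p.1.2.2) /
    (2 * lor (1, p.1.2.1) (1, p.1.2.2)))

/-- The geodesic joining the second point at infinity to the first one, based at the projection
of the point, in the hyperboloid model. -/
noncomputable def vec (t : ℝ) : ℝ × ℂ :=
  Real.exp t • ((p.scale / lor (toHyp p.1.1) (1, p.1.2.1)) • ((1, p.1.2.1) : ℝ × ℂ)) +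
    Real.exp (-t) • ((p.scale / lor (toHyp p.1.1) (1, p.1.2.2)) • ((1, p.1.2.2) : ℝ × ℂ))

theorem left_pos (z : ℍ) : 0 < lor (toHyp z) (1, p.1.2.1) := lor_toHyp_ideal_pos z p.2.1

theorem right_pos (z : ℍ) : 0 < lor (toHyp z) (1, p.1.2.2) := lor_toHyp_ideal_pos z p.2.2.1

theorem ideal_pos : 0 < lor (1, p.1.2.1) (1, p.1.2.2) := lor_ideal_pos p.2.1 p.2.2.1 p.2.2.2

theorem scale_pos : 0 < p.scale := by
  have := p.left_pos p.1.1
  have := p.right_pos p.1.1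
  have := p.ideal_pos
  exact Real.sqrt_pos.2 (by positivity)

theorem scale_sq : p.scale ^ 2 = lor (toHyp p.1.1) (1, p.1.2.1) * lor (toHyp p.1.1) (1, p.1.2.2) /
    (2 * lor (1, p.1.2.1) (1, p.1.2.2)) := by
  have := p.left_pos p.1.1
  have := p.right_pos p.1.1
  have := p.ideal_pos
  exact Real.sq_sqrt (by positivity)

/-- Only the cross terms survive, since the ideal vectors are null, and `scale` is chosen so that
these have product `1 / 2`. -/
theorem lor_vec (s t : ℝ) : lor (p.vec s) (p.vec t) = Real.cosh (s - t) := by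
  have h1 := (p.left_pos p.1.1).ne'
  have h2 := (p.right_pos p.1.1).ne'
  have h3 := p.ideal_pos.ne'
  have h4 := p.scale_sq
  rw [eq_div_iff (by positivity)] at h4
  simp only [vec, lor_add_left, lor_add_right, lor_smul_left, lor_smul_right,
    lor_ideal_self p.2.1, lor_ideal_self p.2.2.1, lor_comm (1, p.1.2.2) (1, p.1.2.1)]
  rw [Real.cosh_eq, neg_sub, sub_eq_add_neg, sub_eq_add_neg, Real.exp_add, Real.exp_add]
  field_simp
  linear_combination ((Real.exp s * Real.exp (-t) + Real.exp t * Real.exp (-s)) *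
    lor (toHyp p.1.1) (1, p.1.2.1) * lor (toHyp p.1.1) (1, p.1.2.2)) * h4

theorem vec_fst_pos (t : ℝ) : 0 < (p.vec t).1 := by
  have := p.left_pos p.1.1
  have := p.right_pos p.1.1
  have := p.scale_pos
  simp only [vec, Prod.fst_add, Prod.smul_fst, smul_eq_mul]
  positivity

theorem lor_vec_self (t : ℝ) : lor (p.vec t) (p.vec t) = 1 := by
  rw [lor_vec, sub_self, Real.cosh_zero]

/-- Joint continuity is what currying needs to give continuity into the space of geodesics with the
compact-open topology. -/
theorem continuous_uncurry_vec : Continuous fun q : AxisData × ℝ => q.1.vec q.2 := by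
  have c1 : Continuous fun q : AxisData × ℝ => toHyp q.1.1.1 :=
    continuous_toHyp.comp (continuous_subtype_val.comp continuous_fst).fst
  have c2 : Continuous fun q : AxisData × ℝ => ((1, q.1.1.2.1) : ℝ × ℂ) :=
    continuous_const.prodMk (continuous_subtype_val.comp continuous_fst).snd.fst
  have c3 : Continuous fun q : AxisData × ℝ => ((1, q.1.1.2.2) : ℝ × ℂ) :=
    continuous_const.prodMk (continuous_subtype_val.comp continuous_fst).snd.snd
  have cl : ∀ {u w : AxisData × ℝ → ℝ × ℂ}, Continuous u → Continuous w →
      Continuous fun q => lor (u q) (w q) := fun hu hw => by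
    unfold lor; fun_prop
  have cs : Continuous fun q : AxisData × ℝ => q.1.scale := by
    unfold scale
    exact (((cl c1 c2).mul (cl c1 c3)).div (continuous_const.mul (cl c2 c3))
      fun q => (mul_pos two_pos q.1.ideal_pos).ne').sqrt
  unfold vec
  exact ((Real.continuous_exp.comp continuous_snd).smul
    ((cs.div (cl c1 c2) fun q => (q.1.left_pos _).ne').smul c2)).add
    ((Real.continuous_exp.comp continuous_snd.neg).smul
    ((cs.div (cl c1 c3) fun q => (q.1.right_pos _).ne').smul c3))

theorem continuous_uncurry_axis : Continuous fun q : AxisData × ℝ => ofHyp (q.1.vec q.2) :=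
  continuous_ofHyp_comp continuous_uncurry_vec (fun q => q.1.lor_vec_self q.2)
    fun q => q.1.vec_fst_pos q.2

/-- The geodesic joining the second point at infinity to the first one, based at the projection
of the point. -/
noncomputable def axis : C(ℝ, ℍ) :=
  ⟨fun t => ofHyp (p.vec t), continuous_uncurry_axis.comp (Continuous.prodMk_right p)⟩

theorem toHyp_axis (t : ℝ) : toHyp (p.axis t) = p.vec t :=
  toHyp_ofHyp (p.lor_vec_self t) (p.vec_fst_pos t)

theorem isometry_axis : Isometry p.axis := by
  refine Isometry.of_dist_eq fun s t => ?_
  have h : Real.cosh (dist (p.axis s) (p.axis t)) = Real.cosh (dist s t) := by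
    rw [← lor_toHyp, toHyp_axis, toHyp_axis, lor_vec, Real.dist_eq, Real.cosh_abs]
  exact eq_of_cosh_eq dist_nonneg dist_nonneg h

theorem cosh_dist_axis (z : ℍ) (t : ℝ) : Real.cosh (dist z (p.axis t)) =
    p.scale / lor (toHyp p.1.1) (1, p.1.2.1) * (Real.exp t * lor (toHyp z) (1, p.1.2.1)) +
    p.scale / lor (toHyp p.1.1) (1, p.1.2.2) * (Real.exp (-t) * lor (toHyp z) (1, p.1.2.2)) := by
  rw [← lor_toHyp, toHyp_axis, vec, lor_add_right, lor_smul_right, lor_smul_right, lor_smul_right,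
    lor_smul_right]
  ring

theorem dist_axis_zero_le (t : ℝ) : dist p.1.1 (p.axis 0) ≤ dist p.1.1 (p.axis t) := by
  have key : ∀ t, Real.cosh (dist p.1.1 (p.axis t)) = 2 * p.scale * Real.cosh t := fun t => by
    have h1 := (p.left_pos p.1.1).ne'
    have h2 := (p.right_pos p.1.1).ne'
    rw [cosh_dist_axis, Real.cosh_eq]
    field_simp
  have h : Real.cosh (dist p.1.1 (p.axis 0)) ≤ Real.cosh (dist p.1.1 (p.axis t)) := by
    rw [key, key, Real.cosh_zero]
    have := p.scale_pos
    have := Real.one_le_cosh t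
    gcongr
  rwa [Real.cosh_le_cosh, abs_of_nonneg dist_nonneg, abs_of_nonneg dist_nonneg] at h

variable {p} {w : ℕ → ℍ} {v : ℝ}

/-- In `cosh_dist_axis` at time `n * v` the term of the forward end is subexponential by hypothesis.
The other one carries `exp (-(n * v))`, so the crude bound `lor_toHyp_ideal_le` by the height is
enough. -/
theorem tendsto_dist_axis (hv : Tendsto (fun n : ℕ => dist I (w n) / n) atTop (𝓝 v))
    (h : SubExp fun n : ℕ => Real.exp (n * v) * lor (toHyp (w n)) (1, p.1.2.1)) :
    Tendsto (fun n : ℕ => dist (w n) (p.axis (n * v)) / n) atTop (𝓝 0) := by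
  have h1 := p.left_pos p.1.1
  have h2 := p.right_pos p.1.1
  have h3 := p.scale_pos
  refine SubExp.tendsto_div_of_cosh (SubExp.mono ((h.const_mul (by positivity :
    0 ≤ p.scale / lor (toHyp p.1.1) (1, p.1.2.1))).add
    (((subExp_exp_neg_mul_toHyp_fst hv).const_mul zero_le_two).const_mul (by positivity :
    0 ≤ p.scale / lor (toHyp p.1.1) (1, p.1.2.2)))) fun n => ?_) fun _ => dist_nonneg
  rw [cosh_dist_axis, mul_left_comm 2]
  gcongr
  exact lor_toHyp_ideal_le _ p.2.2.1

theorem tendsto_dist_axis_neg (hv : Tendsto (fun n : ℕ => dist I (w n) / n) atTop (𝓝 v))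
    (h : SubExp fun n : ℕ => Real.exp (n * v) * lor (toHyp (w n)) (1, p.1.2.2)) :
    Tendsto (fun n : ℕ => dist (w n) (p.axis (-(n * v))) / n) atTop (𝓝 0) := by
  have h1 := p.left_pos p.1.1
  have h2 := p.right_pos p.1.1
  have h3 := p.scale_pos
  refine SubExp.tendsto_div_of_cosh (SubExp.mono ((((subExp_exp_neg_mul_toHyp_fst hv).const_mul
    zero_le_two).const_mul (by positivity : 0 ≤ p.scale / lor (toHyp p.1.1) (1, p.1.2.1))).add
    (h.const_mul (by positivity : 0 ≤ p.scale / lor (toHyp p.1.1) (1, p.1.2.2))))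
    fun n => ?_) fun _ => dist_nonneg
  rw [cosh_dist_axis, mul_left_comm 2, neg_neg]
  gcongr
  exact lor_toHyp_ideal_le _ p.2.1

end AxisData

end Hyperboloid

/-! ### Lifts, deck transformations and orbits of the preferred lift. -/

theorem Isometry.isLocalIsometry {X Y : Type*} [MetricSpace X] [MetricSpace Y] {h : X → Y}
    (hh : Isometry h) : IsLocalIsometry h :=
  fun _ => ⟨Set.univ, univ_mem, fun y _ z _ => hh.dist_eq y z⟩

theorem IsLocalIsometry.comp {X Y Z : Type*} [MetricSpace X] [MetricSpace Y] [MetricSpace Z]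
    {g : Y → Z} {h : X → Y} (hg : IsLocalIsometry g) (hh : IsLocalIsometry h)
    (hc : Continuous h) : IsLocalIsometry (g ∘ h) := fun x => by
  obtain ⟨U, hU, h1⟩ := hg (h x)
  obtain ⟨V, hV, h2⟩ := hh x
  refine ⟨V ∩ h ⁻¹' U, inter_mem hV (hc.continuousAt hU), fun y hy z hz => ?_⟩
  rw [Function.comp_apply, Function.comp_apply, h1 _ hy.2 _ hz.2, h2 _ hy.1 _ hz.1]

theorem IsLocalIsometry.of_comp {X Y Z : Type*} [MetricSpace X] [MetricSpace Y] [MetricSpace Z]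
    {g : Y → Z} {h : X → Y} (hg : IsLocalIsometry g) (hgh : IsLocalIsometry (g ∘ h))
    (hc : Continuous h) : IsLocalIsometry h := fun x => by
  obtain ⟨U, hU, h1⟩ := hg (h x)
  obtain ⟨V, hV, h2⟩ := hgh x
  refine ⟨V ∩ h ⁻¹' U, inter_mem hV (hc.continuousAt hU), fun y hy z hz => ?_⟩
  rw [← h1 _ hy.2 _ hz.2]
  exact h2 _ hy.1 _ hz.1

open Hyperboloid

namespace HyperbolicSurface

variable {S : Type*} [MetricSpace S] (c : HyperbolicSurface S)

theorem dist_deck {g : ℍ ≃ₜ ℍ} (hg : IsDeck c.proj g) (z w : ℍ) : dist (g z) (g w) = dist z w := by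
  obtain ⟨A, hA⟩ := c.orientable g hg
  rw [hA, hA, dist_smul]

variable {f : S ≃ₜ S} (hf : IsIsotopicToId f)

theorem preferredLift_pow_deck {g : ℍ ≃ₜ ℍ} (hg : IsDeck c.proj g) (n : ℕ) (z : ℍ) :
    (c.preferredLift hf ^ n) (g z) = g ((c.preferredLift hf ^ n) z) := by
  have h : Commute (c.preferredLift hf) g :=
    Homeomorph.ext ((c.isPreferredLift_preferredLift hf).commutes g hg)
  exact congrArg (fun k : ℍ ≃ₜ ℍ => k z) (h.pow_left n).eq

theorem preferredLift_zpow_deck {g : ℍ ≃ₜ ℍ} (hg : IsDeck c.proj g) (n : ℤ) (z : ℍ) :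
    (c.preferredLift hf ^ n) (g z) = g ((c.preferredLift hf ^ n) z) := by
  have h : Commute (c.preferredLift hf) g :=
    Homeomorph.ext ((c.isPreferredLift_preferredLift hf).commutes g hg)
  exact congrArg (fun k : ℍ ≃ₜ ℍ => k z) (h.zpow_left n).eq

theorem proj_preferredLift_pow (n : ℕ) (z : ℍ) :
    c.proj ((c.preferredLift hf ^ n) z) = (f ^ n) (c.proj z) := by
  induction n with
  | zero => rfl
  | succ n ih =>
    rw [pow_succ', pow_succ', Homeomorph.mul_apply, Homeomorph.mul_apply,
      (c.isPreferredLift_preferredLift hf).proj_apply, ih]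

theorem preferredLift_pow_zpow_neg (n : ℕ) (z : ℍ) :
    (c.preferredLift hf ^ n) ((c.preferredLift hf ^ (-(n : ℤ))) z) = z := by
  rw [← Homeomorph.mul_apply, ← zpow_natCast, ← zpow_add, add_neg_cancel, zpow_zero]
  rfl

theorem proj_preferredLift_zpow_neg (n : ℕ) (z : ℍ) :
    c.proj ((c.preferredLift hf ^ (-(n : ℤ))) z) = (f ^ (-(n : ℤ))) (c.proj z) := by
  apply (f ^ n).injective
  rw [← c.proj_preferredLift_pow hf, preferredLift_pow_zpow_neg, ← Homeomorph.mul_apply,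
    ← zpow_natCast, ← zpow_add, add_neg_cancel, zpow_zero]
  rfl

theorem rotationDist_zpow_neg_proj (n : ℕ) (z : ℍ) :
    c.rotationDist hf n ((f ^ (-(n : ℤ))) (c.proj z)) =
      dist z ((c.preferredLift hf ^ (-(n : ℤ))) z) := by
  rw [← c.proj_preferredLift_zpow_neg hf, rotationDist_proj, preferredLift_pow_zpow_neg, dist_comm]

/-- Expresses the distance between past and future in the cover through a function on `S`, where
invariant measures can be used. -/
theorem rotationDist_two_mul_zpow_neg_proj (n : ℕ) (z : ℍ) :
    c.rotationDist hf (2 * n) ((f ^ (-(n : ℤ))) (c.proj z)) =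
      dist ((c.preferredLift hf ^ (-(n : ℤ))) z) ((c.preferredLift hf ^ n) z) := by
  rw [← c.proj_preferredLift_zpow_neg hf, rotationDist_proj, two_mul, pow_add,
    Homeomorph.mul_apply, preferredLift_pow_zpow_neg]

theorem hasRotationSpeed_proj_iff {z : ℍ} {v : ℝ} : c.HasRotationSpeed hf (c.proj z) v ↔
    Tendsto (fun n : ℕ => dist z ((c.preferredLift hf ^ n) z) / n) atTop (𝓝 v) ∧
      Tendsto (fun n : ℕ => dist z ((c.preferredLift hf ^ (-(n : ℤ))) z) / n) atTop (𝓝 v) := by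
  simp only [HasRotationSpeed, rotationDist_proj, rotationDist_zpow_neg_proj]

theorem continuous_rotationDist (n : ℕ) : Continuous (c.rotationDist hf n) := by
  rw [(c.isCoveringMap.isQuotientMap c.surjective).continuous_iff]
  have : c.rotationDist hf n ∘ c.proj = fun z => dist z ((c.preferredLift hf ^ n) z) :=
    funext fun z => c.rotationDist_proj hf n z
  rw [this]
  exact continuous_id.dist (c.preferredLift hf ^ n).continuous

theorem exists_dist_preferredLift_le [CompactSpace S] :
    ∃ K, ∀ z, dist z (c.preferredLift hf z) ≤ K := by
  obtain ⟨K, hK⟩ := (isCompact_range (c.continuous_rotationDist hf 1)).bddAbove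
  refine ⟨K, fun z => ?_⟩
  have := hK ⟨c.proj z, rfl⟩
  rwa [rotationDist_proj, pow_one] at this

variable {c hf} in
theorem Tracks.deck {z : ℍ} {γ' : C(ℝ, ℍ)} {v : ℝ} (h : c.Tracks hf z γ' v) {g : ℍ ≃ₜ ℍ}
    (hg : IsDeck c.proj g) : c.Tracks hf (g z) ((g : C(ℍ, ℍ)).comp γ') v := by
  simpa only [Tracks, preferredLift_pow_deck c hf hg, preferredLift_zpow_deck c hf hg,
    ContinuousMap.comp_apply, ContinuousMap.coe_coe, dist_deck c hg] using h

theorem tendsto_dist_const_div {X : Type*} [PseudoMetricSpace X] (x y : X) {w : ℕ → X} {v : ℝ}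
    (h : Tendsto (fun n : ℕ => dist x (w n) / n) atTop (𝓝 v)) :
    Tendsto (fun n : ℕ => dist y (w n) / n) atTop (𝓝 v) := by
  have h0 : Tendsto (fun n : ℕ => dist x y / (n : ℝ)) atTop (𝓝 0) :=
    tendsto_const_div_atTop_nhds_zero_nat _
  refine tendsto_of_tendsto_of_tendsto_of_le_of_le (by simpa using h.sub h0) (by simpa using h.add h0)
    (fun n => ?_) fun n => ?_
  · simp only [← sub_div]
    gcongr
    linarith [dist_triangle x y (w n)]
  · simp only [← add_div]
    gcongr
    linarith [dist_triangle_left y (w n) x]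

/-- The past and the future orbits each have an end; equal ends would contradict `hne`. The Klein
limits are kept in the conclusion because they show that the ends depend measurably on `z`. -/
theorem exists_axisData [CompactSpace S] {z : ℍ} {v : ℝ} (hv : 0 < v)
    (hs : c.HasRotationSpeed hf (c.proj z) v)
    (hne : ¬ Tendsto (fun n : ℕ => c.rotationDist hf (2 * n) ((f ^ (-(n : ℤ))) (c.proj z)) / n)
      atTop (𝓝 0)) :
    ∃ p : AxisData, p.1.1 = z ∧
      Tendsto (fun n : ℕ => klein ((c.preferredLift hf ^ n) z)) atTop (𝓝 p.1.2.1) ∧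
      Tendsto (fun n : ℕ => klein ((c.preferredLift hf ^ (-(n : ℤ))) z)) atTop (𝓝 p.1.2.2) ∧
      c.Tracks hf z p.axis v := by
  obtain ⟨K, hK⟩ := c.exists_dist_preferredLift_le hf
  rw [hasRotationSpeed_proj_iff] at hs
  have hs1 := tendsto_dist_const_div z I hs.1
  have hs2 := tendsto_dist_const_div z I hs.2
  obtain ⟨θ, hθ, hθt, hθs⟩ := exists_direction (K := K) (fun n => by
    rw [pow_succ', Homeomorph.mul_apply]; exact hK _) hv hs1
  obtain ⟨η, hη, hηt, hηs⟩ := exists_direction (K := K) (fun n => by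
    have := hK ((c.preferredLift hf ^ (-((n + 1 : ℕ) : ℤ))) z)
    rw [← Homeomorph.mul_apply, ← zpow_one_add,
      show 1 + -((n + 1 : ℕ) : ℤ) = -(n : ℤ) by push_cast; ring, dist_comm] at this
    exact this) hv hs2
  have hθη : θ ≠ η := by
    rintro rfl
    refine hne ?_
    simp only [rotationDist_two_mul_zpow_neg_proj]
    exact tendsto_dist_div_of_same_direction hθ hs2 hs1 hηs hθs
  let p : AxisData := ⟨(z, θ, η), hθ, hη, hθη⟩
  exact ⟨p, rfl, hθt, hηt, AxisData.tendsto_dist_axis hs1 hθs,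
    AxisData.tendsto_dist_axis_neg hs2 hηs⟩

/-- The projection of the axis to the surface. -/
noncomputable def axisGeodesic (p : AxisData) : Geodesic S :=
  ⟨⟨fun t => c.proj (p.axis t), c.isCoveringMap.continuous.comp p.axis.continuous⟩,
    c.isLocalIsometry.comp p.isometry_axis.isLocalIsometry p.axis.continuous⟩

theorem continuous_axisGeodesic : Continuous c.axisGeodesic := by
  have h : Continuous fun q : AxisData × ℝ => c.proj (ofHyp (q.1.vec q.2)) :=
    c.isCoveringMap.continuous.comp AxisData.continuous_uncurry_axis
  exact (ContinuousMap.curry ⟨_, h⟩).continuous.subtype_mk _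

theorem isGeodesicLift_axis (p : AxisData) : c.IsGeodesicLift (c.axisGeodesic p) p.axis :=
  fun _ => rfl

end HyperbolicSurface

/-! ### Normalized tracking geodesics and the tracking criterion. -/

namespace HyperbolicSurface

variable {S : Type*} [MetricSpace S] (c : HyperbolicSurface S) {f : S ≃ₜ S}
  (hf : IsIsotopicToId f)

variable {c hf}

theorem IsGeodesicLift.deck {γ : Geodesic S} {γ' : C(ℝ, ℍ)} (h : c.IsGeodesicLift γ γ')
    {g : ℍ ≃ₜ ℍ} (hg : IsDeck c.proj g) : c.IsGeodesicLift γ ((g : C(ℍ, ℍ)).comp γ') :=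
  fun t => (hg _).trans (h t)

theorem IsGeodesicLift.isLocalIsometry {γ : Geodesic S} {γ' : C(ℝ, ℍ)}
    (h : c.IsGeodesicLift γ γ') : IsLocalIsometry γ' := by
  refine c.isLocalIsometry.of_comp (h := γ') ?_ γ'.continuous
  rw [show c.proj ∘ γ' = γ from funext h]
  exact γ.2

theorem HasRotationSpeed.unique {x : S} {v w : ℝ} (hv : c.HasRotationSpeed hf x v)
    (hw : c.HasRotationSpeed hf x w) : v = w :=
  tendsto_nhds_unique hv.1 hw.1

/-- One tracked lift suffices: deck transformations are isometries commuting with the preferred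
lift, and they act transitively on the lifts of a point. -/
theorem isTrackingGeodesic_of_tracks {z : ℍ} {γ : Geodesic S} {γ' : C(ℝ, ℍ)} {v : ℝ}
    (hv : 0 < v) (hs : c.HasRotationSpeed hf (c.proj z) v) (hγ : c.IsGeodesicLift γ γ')
    (ht : c.Tracks hf z γ' v) : c.IsTrackingGeodesic hf (c.proj z) γ := by
  refine ⟨v, hv, hs, fun y hy => ?_⟩
  obtain ⟨g, hg, rfl⟩ := c.exists_deck hy.symm
  exact ⟨_, hγ.deck hg, ht.deck hg⟩

theorem isNormalizedTrackingGeodesic_axis {p : AxisData} {v : ℝ} (hv : 0 < v)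
    (hs : c.HasRotationSpeed hf (c.proj p.1.1) v) (ht : c.Tracks hf p.1.1 p.axis v) :
    c.IsNormalizedTrackingGeodesic hf (c.proj p.1.1) (c.axisGeodesic p) := by
  refine ⟨isTrackingGeodesic_of_tracks hv hs (c.isGeodesicLift_axis p) ht, v, hs, p.1.1, p.axis,
    rfl, c.isGeodesicLift_axis p, ht, le_antisymm ?_ (Metric.infDist_le_dist_of_mem ⟨0, rfl⟩)⟩
  refine (Metric.le_infDist (Set.range_nonempty _)).2 ?_
  rintro _ ⟨t, rfl⟩
  exact p.dist_axis_zero_le t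

theorem IsNormalizedTrackingGeodesic.unique {x : S} {γ₁ γ₂ : Geodesic S}
    (h₁ : c.IsNormalizedTrackingGeodesic hf x γ₁) (h₂ : c.IsNormalizedTrackingGeodesic hf x γ₂) :
    γ₁ = γ₂ := by
  obtain ⟨⟨v, hv, hs, -⟩, v₁, hs₁, z, δ₁, rfl, l₁, t₁, m₁⟩ := h₁
  obtain ⟨-, v₂, hs₂, y, δ₂, hy, l₂, t₂, m₂⟩ := h₂
  obtain rfl := hs.unique hs₁
  obtain rfl := hs.unique hs₂
  obtain ⟨g, hg, rfl⟩ := c.exists_deck hy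
  have t₂' := t₂.deck hg
  have l₂' := l₂.deck hg
  have sublin : ∀ {a b w : ℕ → ℍ}, Tendsto (fun n : ℕ => dist (w n) (a n) / n) atTop (𝓝 0) →
      Tendsto (fun n : ℕ => dist (w n) (b n) / n) atTop (𝓝 0) →
      Tendsto (fun n : ℕ => dist (a n) (b n) / n) atTop (𝓝 0) := fun {a b w} ha hb => by
    refine squeeze_zero (fun n => by positivity) (fun n => ?_) (by simpa using ha.add hb)
    rw [← add_div]
    gcongr
    exact dist_triangle_left _ _ _
  have e := eq_of_sublinear_of_isMin l₁.isLocalIsometry l₂'.isLocalIsometry hv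
    (sublin t₁.1 t₂'.1) (sublin t₁.2 t₂'.2) (z := g y)
    (fun t => m₁.trans_le (Metric.infDist_le_dist_of_mem ⟨t, rfl⟩))
    (fun t => by
      simp only [ContinuousMap.comp_apply, ContinuousMap.coe_coe, dist_deck c hg]
      exact m₂.trans_le (Metric.infDist_le_dist_of_mem ⟨t, rfl⟩))
  apply Subtype.ext
  ext t
  exact (l₁ t).symm.trans ((congrArg c.proj (congrFun e t)).trans (l₂' t))

variable (c hf)

/-- The normalized distance between the past and the future of a point at time `n`. -/
noncomputable def spread (n : ℕ) (x : S) : ℝ :=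
  c.rotationDist hf (2 * n) ((f ^ (-(n : ℤ))) x) / n

/-- A lift of a tracking geodesic is globally an isometry, so its points at times `±nv` are `2nv`
apart, and the tracked past and future cannot be at sublinear distance. The converse is
`exists_axisData`. -/
theorem mem_trackingSet_iff [CompactSpace S] {x : S} : x ∈ c.trackingSet hf ↔
    (∃ v : ℝ, 0 < v ∧ c.HasRotationSpeed hf x v) ∧
      ¬ Tendsto (fun n => c.spread hf n x) atTop (𝓝 0) := by
  constructor
  · rintro ⟨γ, v, hv, hs, h⟩
    refine ⟨⟨v, hv, hs⟩, fun h0 => ?_⟩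
    obtain ⟨z, rfl⟩ := c.surjective x
    obtain ⟨γ', hl, ht⟩ := h z rfl
    have hiso := isometry_of_isLocalIsometry hl.isLocalIsometry
    have hlim : Tendsto (fun n : ℕ => dist (γ' (n * v)) (γ' (-(n * v))) / n) atTop (𝓝 0) := by
      have h1 := (ht.1.add h0).add ht.2
      rw [add_zero, add_zero] at h1
      refine squeeze_zero (fun n => div_nonneg dist_nonneg n.cast_nonneg) (fun n => ?_) h1
      rw [spread, rotationDist_two_mul_zpow_neg_proj, ← add_div, ← add_div]
      refine div_le_div_of_nonneg_right ?_ n.cast_nonneg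
      rw [dist_comm ((c.preferredLift hf ^ n) z) (γ' (n * v)),
        dist_comm ((c.preferredLift hf ^ (-(n : ℤ))) z) ((c.preferredLift hf ^ n) z)]
      exact dist_triangle4 _ _ _ _
    obtain ⟨n, hn, hn0⟩ := ((hlim.eventually (gt_mem_nhds hv)).and
      (eventually_gt_atTop 0)).exists
    have hn1 : (0 : ℝ) < n := by exact_mod_cast hn0
    rw [div_lt_iff₀ hn1] at hn
    rw [hiso.dist_eq, Real.dist_eq, sub_neg_eq_add, abs_of_pos (by positivity)] at hn
    nlinarith [mul_pos hn1 hv]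
  · rintro ⟨⟨v, hv, hs⟩, hne⟩
    obtain ⟨z, rfl⟩ := c.surjective x
    obtain ⟨p, rfl, -, -, ht⟩ := c.exists_axisData hf hv hs hne
    exact ⟨_, isTrackingGeodesic_of_tracks hv hs (c.isGeodesicLift_axis p) ht⟩

theorem exists_axisData_of_mem [CompactSpace S] {z : ℍ} (hz : c.proj z ∈ c.trackingSet hf) :
    ∃ p : AxisData, p.1.1 = z ∧
      Tendsto (fun n : ℕ => klein ((c.preferredLift hf ^ n) z)) atTop (𝓝 p.1.2.1) ∧
      Tendsto (fun n : ℕ => klein ((c.preferredLift hf ^ (-(n : ℤ))) z)) atTop (𝓝 p.1.2.2) ∧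
      c.IsNormalizedTrackingGeodesic hf (c.proj z) (c.axisGeodesic p) := by
  obtain ⟨⟨v, hv, hs⟩, hne⟩ := (c.mem_trackingSet_iff hf).1 hz
  obtain ⟨p, rfl, h1, h2, ht⟩ := c.exists_axisData hf hv hs hne
  exact ⟨p, rfl, h1, h2, isNormalizedTrackingGeodesic_axis hv hs ht⟩

/-! ### Measurability and invariant measures. -/

variable [MeasurableSpace S] [BorelSpace S]

theorem measurable_spread (n : ℕ) : Measurable (c.spread hf n) :=
  (((c.continuous_rotationDist hf (2 * n)).comp
    (f ^ (-(n : ℤ))).continuous).div_const _).measurable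

theorem measurableSet_trackingSet [CompactSpace S] : MeasurableSet (c.trackingSet hf) := by
  let a : ℕ → S → ℝ := fun n x => c.rotationDist hf n x / n
  let b : ℕ → S → ℝ := fun n x => c.rotationDist hf n ((f ^ (-(n : ℤ))) x) / n
  have ha : ∀ n, Measurable (a n) := fun n =>
    ((c.continuous_rotationDist hf n).div_const _).measurable
  have hb : ∀ n, Measurable (b n) := fun n =>
    (((c.continuous_rotationDist hf n).comp (f ^ (-(n : ℤ))).continuous).div_const _).measurable
  -- The uncountable quantifier over the speed is removed: the forward averages converge, not to
  -- `0`, and the backward ones have the same limit. Positivity is automatic since distances are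
  -- nonnegative.
  have e : c.trackingSet hf = (({x | ∃ v, Tendsto (fun n => a n x) atTop (𝓝 v)} ∩
      {x | Tendsto (fun n => a n x) atTop (𝓝 0)}ᶜ) ∩
      {x | Tendsto (fun n => b n x - a n x) atTop (𝓝 0)}) ∩
      {x | Tendsto (fun n => c.spread hf n x) atTop (𝓝 0)}ᶜ := by
    ext x
    rw [mem_trackingSet_iff]
    refine and_congr ⟨?_, ?_⟩ Iff.rfl
    · rintro ⟨v, hv, h1, h2⟩
      exact ⟨⟨⟨v, h1⟩, fun h0 => hv.ne' (tendsto_nhds_unique h1 h0)⟩, sub_self v ▸ h2.sub h1⟩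
    · rintro ⟨⟨⟨v, h1⟩, h0⟩, h2⟩
      have hv : 0 ≤ v := ge_of_tendsto' h1 fun n => div_nonneg dist_nonneg n.cast_nonneg
      refine ⟨v, lt_of_le_of_ne hv ?_, h1, ?_⟩
      · rintro rfl
        exact h0 h1
      · have h3 := (show Tendsto (fun n => b n x - a n x) atTop (𝓝 0) from h2).add h1
        simp only [sub_add_cancel, zero_add] at h3
        exact h3
  rw [e]
  exact (((measurableSet_exists_tendsto ha).inter (measurableSet_tendsto _ ha).compl).inter
    (measurableSet_tendsto _ fun n => (hb n).sub (ha n))).inter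
    (measurableSet_tendsto _ (c.measurable_spread hf)).compl

/-- The spread at time `n` is `L_{2n} / n` composed with `f^{-n}`. Almost sure convergence need not
survive a composition that varies with `n`, but convergence in measure does, as the deviation sets
keep their measure; a subsequence then converges almost surely to `2 * v`. -/
theorem ae_mem_trackingSet [CompactSpace S] {μ : Measure S} [IsFiniteMeasure μ] (hμ : MeasurePreserving f μ μ)
    {v : ℝ} (hv : 0 < v) (hs : c.MeasureHasRotationSpeed hf μ v) :
    ∀ᵐ x ∂μ, x ∈ c.trackingSet hf := by
  let a : ℕ → S → ℝ := fun n x => c.rotationDist hf (2 * n) x / n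
  have ha : ∀ n, Measurable (a n) := fun n =>
    ((c.continuous_rotationDist hf (2 * n)).div_const _).measurable
  have h1 : TendstoInMeasure μ a atTop fun _ => 2 * v := by
    refine tendstoInMeasure_of_tendsto_ae (fun n => (ha n).aestronglyMeasurable) ?_
    filter_upwards [hs] with x hx
    have h2 : Tendsto (fun n : ℕ => 2 * n) atTop atTop :=
      tendsto_id.const_mul_atTop' two_pos
    refine ((hx.1.comp h2).const_mul 2).congr fun n => ?_
    simp only [Function.comp_apply, a]
    push_cast
    rw [mul_div_assoc', mul_div_mul_left _ _ two_ne_zero]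
  have hpow : ∀ n : ℕ, MeasurePreserving (f ^ (-(n : ℤ))) μ μ := fun n => by
    have hn : MeasurePreserving (f ^ n) μ μ := by
      induction n with
      | zero => exact MeasurePreserving.id μ
      | succ n ih => rw [pow_succ']; exact hμ.comp ih
    have := MeasurePreserving.symm (f ^ n).toMeasurableEquiv hn
    rw [zpow_neg, zpow_natCast]
    exact this
  have h2 : TendstoInMeasure μ (fun n => c.spread hf n) atTop fun _ => 2 * v := by
    intro ε hε
    refine (h1 ε hε).congr fun n => ?_
    have hm : MeasurableSet {x | ε ≤ edist (a n x) (2 * v)} :=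
      measurableSet_le measurable_const ((ha n).edist measurable_const)
    exact ((hpow n).measure_preimage hm.nullMeasurableSet).symm
  obtain ⟨ns, hns, hae⟩ := h2.exists_seq_tendsto_ae
  filter_upwards [hs, hae] with x hx hlim
  refine (c.mem_trackingSet_iff hf).2 ⟨⟨v, hv, hx⟩, fun h0 => ?_⟩
  have := tendsto_nhds_unique hlim (h0.comp hns.tendsto_atTop)
  linarith

theorem exists_measurable_normalizedTrackingGeodesic [CompactSpace S] :
    ∃ Φ : c.trackingSet hf → Geodesic S, Measurable Φ ∧
      ∀ x : c.trackingSet hf, c.IsNormalizedTrackingGeodesic hf x (Φ x) := by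
  have hmeas : Measurable c.proj := c.isCoveringMap.continuous.measurable
  have hT : MeasurableSet (c.proj ⁻¹' c.trackingSet hf) := hmeas (c.measurableSet_trackingSet hf)
  have : StandardBorelSpace (c.proj ⁻¹' c.trackingSet hf) := hT.standardBorel
  choose q hq1 hq2 hq3 hq4 using
    fun z : c.proj ⁻¹' c.trackingSet hf => c.exists_axisData_of_mem hf z.2
  have hq : Measurable q := by
    have m1 : Measurable fun z => (q z).1.1 := by
      simp only [hq1]; exact measurable_subtype_coe
    have m2 : Measurable fun z => (q z).1.2.1 :=
      measurable_of_tendsto_metrizable (fun n : ℕ => ((continuous_klein.comp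
        (c.preferredLift hf ^ n).continuous).comp continuous_subtype_val).measurable)
        (tendsto_pi_nhds.2 hq2)
    have m3 : Measurable fun z => (q z).1.2.2 :=
      measurable_of_tendsto_metrizable (fun n : ℕ => ((continuous_klein.comp
        (c.preferredLift hf ^ (-(n : ℤ))).continuous).comp continuous_subtype_val).measurable)
        (tendsto_pi_nhds.2 hq3)
    exact (m1.prodMk (m2.prodMk m3)).subtype_mk
  let π : c.proj ⁻¹' c.trackingSet hf → c.trackingSet hf := fun z => ⟨c.proj z, z.2⟩
  have hπ : Measurable π := (hmeas.comp measurable_subtype_coe).subtype_mk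
  have hπs : Function.Surjective π := by
    rintro ⟨x, hx⟩
    obtain ⟨z, rfl⟩ := c.surjective x
    exact ⟨⟨z, hx⟩, rfl⟩
  choose s hs using hπs
  have key : ∀ x : c.trackingSet hf, c.IsNormalizedTrackingGeodesic hf x (c.axisGeodesic (q (s x))) :=
      fun x => by
    have h1 := hq4 (s x)
    rwa [show c.proj (s x) = x from congrArg Subtype.val (hs x)] at h1
  refine ⟨fun x => c.axisGeodesic (q (s x)), ?_, key⟩
  -- The section `s` is arbitrary and need not be measurable. It is enough to test measurability
  -- after the Borel surjection `π` from a standard Borel space, and there uniqueness replaces `q (s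
  -- (π z))` by the measurable `q z`.
  rw [← hπ.measurable_comp_iff_of_surjective fun x => ⟨s x, hs x⟩]
  have e : (fun x => c.axisGeodesic (q (s x))) ∘ π = fun z => c.axisGeodesic (q z) :=
    funext fun z => (key (π z)).unique (hq4 z)
  rw [e]
  exact c.continuous_axisGeodesic.measurable.comp hq

end HyperbolicSurface

theorem theorem1p7 {S : Type*} [MetricSpace S] [CompactSpace S] [MeasurableSpace S] [BorelSpace S]
    (c : HyperbolicSurface S) (f : S ≃ₜ S) (hf : IsIsotopicToId f) :
    MeasurableSet (c.trackingSet hf) ∧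
      (∀ μ : Measure S, IsProbabilityMeasure μ → Ergodic f μ →
        (∃ v : ℝ, 0 < v ∧ c.MeasureHasRotationSpeed hf μ v) →
          μ (c.trackingSet hf)ᶜ = 0) ∧
      ∃ Φ : c.trackingSet hf → Geodesic S, Measurable Φ ∧
        ∀ (x : c.trackingSet hf) (γ : Geodesic S),
          c.IsNormalizedTrackingGeodesic hf x γ ↔ γ = Φ x := by
  refine ⟨c.measurableSet_trackingSet hf, fun μ _ hμ ⟨v, hv, hs⟩ =>
    c.ae_mem_trackingSet hf hμ.toMeasurePreserving hv hs, ?_⟩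
  obtain ⟨Φ, hΦ, h⟩ := c.exists_measurable_normalizedTrackingGeodesic hf
  exact ⟨Φ, hΦ, fun x γ => ⟨fun hγ => hγ.unique (h x), fun e => e ▸ h x⟩⟩
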